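/- Let $n\ge 1$ and let $G\in M_{n,m}$, $H\in M_{m,q}$, $K\in M_{n,p}$, $L\in M_{p,q}$ be matrices with non-negative integer entries, none of which has a zero column, such that $$GH=KL\qquad\text{and}\qquad G^{t}K=HL^{t}.$$ *Conventions.* A multi-matrix algebra is a finite direct sum of full matrix algebras $M_r(\mathbb C)$, $r\ge 1$; inclusions are inclusions of unital $*$-subalgebras. An inclusion $A\subset B$ of multi-matrix algebras $A=\bigoplus_i A_i$, $B=\bigoplus_j B_j$ has inclusion matrix $G$, written $A\subset_G B$, if every minimal projection of $A_i$ has rank $G_{ij}$ in $B_j$ for all $i,j$. The trace weights of a trace on $A$ are its values on the minimal projections of the summands $A_i$. A commuting square with inclusion matrices $G,H,K,L$ consists of multi-matrix algebras $A\subset_G B\subset_H D$, $A\subset_K C\subset_L D$ and a faithful tracial state $\mathrm{tr}_D$ on $D$ such that the $\mathrm{tr}_D$-preserving conditional expectations $E_A,E_B,E_C$ of $D$ onto $A,B,C$ satisfy $E_A=E_BE_C=E_CE_B$; it is symmetric if also $G^tK=HL^t$ (which is assumed here). A weight system is a quadruple of strictly positive real vectors $\alpha\in\mathbb R^n$, $\beta\in\mathbb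 R^m$, $\gamma\in\mathbb R^p$, $\delta\in\mathbb R^q$ with $\beta=H\delta$, $\gamma=L\delta$ and $\alpha=G\beta=K\gamma$. A pair $(u,v)$ satisfies the bi-unitary condition for a weight system $(\alpha,\beta,\gamma,\delta)$ if $u=\bigoplus_{(i,k)}u^{(i,k)}$ and $v=\bigoplus_{(j,l)}v^{(j,l)}$, where all the blocks $$u^{(i,k)}=\Bigl(u^{(i,k)}_{(j,\rho,\sigma)(l,\phi,\psi)}\Bigr),\qquad v^{(j,l)}=\Bigl(v^{(j,l)}_{(i,\rho,\phi)(k,\sigma,\psi)}\Bigr)$$ are unitary complex matrices (row index first, column index second), the indices running over $1\le i\le n$, $1\le j\le m$, $1\le l\le p$, $1\le k\le q$, $1\le\rho\le G_{ij}$, $1\le\sigma\le H_{jk}$, $1\le\phi\le K_{il}$, $1\le\psi\le L_{lk}$, and $$v^{(j,l)}_{(i,\rho,\phi)(k,\sigma,\psi)}=\sqrt{\frac{\alpha_i\delta_k}{\beta_j\gamma_l}}\;u^{(i,k)}_{(j,\rho,\sigma)(l,\phi,\psi)}$$ for all such indices. *Theorem.* The following are equivalent: (a) there is a (symmetric) commuting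 square $(A\subset B\subset D,\ A\subset C\subset D,\ \mathrm{tr}_D)$ of multi-matrix algebras with inclusion matrices $A\subset_G B\subset_H D$ and $A\subset_K C\subset_L D$; (b) there are a weight system $(\alpha,\beta,\gamma,\delta)$ and a pair $(u,v)$ satisfying the bi-unitary condition for it. Moreover, the trace can be prescribed: for every weight system $(\alpha,\beta,\gamma,\delta)$, there is a pair $(u,v)$ satisfying the bi-unitary condition for it if and only if there is a commuting square as in (a) for which the trace weights of $\mathrm{tr}_D$ on $A$, $B$, $C$, $D$ are $c\alpha$, $c\beta$, $c\gamma$, $c\delta$ for some constant $c>0$. -/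

import Mathlib

open scoped Matrix ComplexOrder

/-- The multi-matrix algebra `⨁ i, M_{d i}(ℂ)` (a finite product of full matrix algebras), as a
unital `*`-algebra over `ℂ`. -/
abbrev MultiMat {n : ℕ} (d : Fin n → ℕ) : Type :=
  (i : Fin n) → Matrix (Fin (d i)) (Fin (d i)) ℂ

/-- A minimal projection of a full matrix algebra: an orthogonal projection of rank one. -/
def IsMinProj {r : ℕ} (e : Matrix (Fin r) (Fin r) ℂ) : Prop :=
  IsStarProjection e ∧ e.rank = 1

/-- The unital `*`-homomorphism `f` between multi-matrix algebras has inclusion matrix `G`: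
the multiplicity `G i j` of the `i`-th summand of the source in the `j`-th summand of the target
is the rank, in the `j`-th summand, of the image of any minimal projection of the `i`-th summand. -/
def HasInclusionMatrix {n m : ℕ} {a : Fin n → ℕ} {b : Fin m → ℕ}
    (f : MultiMat a →⋆ₐ[ℂ] MultiMat b) (G : Matrix (Fin n) (Fin m) ℕ) : Prop :=
  ∀ (i : Fin n) (e : Matrix (Fin (a i)) (Fin (a i)) ℂ), IsMinProj e →
    ∀ j : Fin m, (f (Pi.single i e) j).rank = G i j

/-- `w` is the vector of trace weights of the linear functional `τ`: the value of `τ` at any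
minimal projection of the `i`-th summand is `w i`. -/
def HasTraceWeights {n : ℕ} {a : Fin n → ℕ} (τ : MultiMat a →ₗ[ℂ] ℂ) (w : Fin n → ℝ) : Prop :=
  ∀ (i : Fin n) (e : Matrix (Fin (a i)) (Fin (a i)) ℂ), IsMinProj e →
    τ (Pi.single i e) = (w i : ℂ)

/-- A faithful tracial state. -/
structure IsFaithfulTracialState {q : ℕ} {d : Fin q → ℕ} (τ : MultiMat d →ₗ[ℂ] ℂ) : Prop where
  map_one : τ 1 = 1
  nonneg : ∀ x, 0 ≤ τ (star x * x)
  faithful : ∀ x, τ (star x * x) = 0 → x = 0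
  tracial : ∀ x y, τ (x * y) = τ (y * x)

/-- `E` is a conditional expectation of `D = MultiMat d` onto the unital `*`-subalgebra `X`
that preserves `τ`; `E` is regarded as a map `D → D` with values in `X`. -/
structure IsTraceCondExp {q : ℕ} {d : Fin q → ℕ} (τ : MultiMat d →ₗ[ℂ] ℂ)
    (X : StarSubalgebra ℂ (MultiMat d)) (E : MultiMat d →ₗ[ℂ] MultiMat d) : Prop where
  mem : ∀ x, E x ∈ X
  apply_of_mem : ∀ x ∈ X, E x = x
  bimodule : ∀ x ∈ X, ∀ y ∈ X, ∀ z, E (x * z * y) = x * E z * y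
  positive : ∀ z : MultiMat d, (∀ k, (z k).PosSemidef) → ∀ k, (E z k).PosSemidef
  preserves : ∀ z, τ (E z) = τ z

/-- A unital `*`-subalgebra of `MultiMat d` that is itself a multi-matrix algebra with `n` nonzero
simple summands, together with a labelling of its summands given by a `*`-isomorphism. -/
structure MultiMatSubalgebra {q : ℕ} (d : Fin q → ℕ) (n : ℕ) where
  alg : StarSubalgebra ℂ (MultiMat d)
  dim : Fin n → ℕ
  dim_pos : ∀ i, 0 < dim i
  iso : MultiMat dim ≃⋆ₐ[ℂ] alg

namespace MultiMatSubalgebra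

variable {q : ℕ} {d : Fin q → ℕ}

/-- The inclusion of a multi-matrix subalgebra into the ambient algebra, in coordinates. -/
def toAmbient {n : ℕ} (A : MultiMatSubalgebra d n) : MultiMat A.dim →⋆ₐ[ℂ] MultiMat d :=
  A.alg.subtype.comp (A.iso : MultiMat A.dim →⋆ₐ[ℂ] A.alg)

/-- The inclusion `A ⊆ B` of multi-matrix subalgebras, in coordinates. -/
def incl {n m : ℕ} (A : MultiMatSubalgebra d n) (B : MultiMatSubalgebra d m)
    (h : A.alg ≤ B.alg) : MultiMat A.dim →⋆ₐ[ℂ] MultiMat B.dim :=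
  (B.iso.symm : B.alg →⋆ₐ[ℂ] MultiMat B.dim).comp
    ((StarSubalgebra.inclusion h).comp (A.iso : MultiMat A.dim →⋆ₐ[ℂ] A.alg))

end MultiMatSubalgebra

/-- A commuting square `A ⊆ B ⊆ D`, `A ⊆ C ⊆ D` of multi-matrix algebras with respect to a faithful
tracial state `tr` on `D`, with inclusion matrices
`A ⊂_G B`, `B ⊂_H D`, `A ⊂_K C`, `C ⊂_L D`. Here `D = MultiMat d`. -/
structure CommutingSquare {n m p q : ℕ}
    (G : Matrix (Fin n) (Fin m) ℕ) (H : Matrix (Fin m) (Fin q) ℕ)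
    (K : Matrix (Fin n) (Fin p) ℕ) (L : Matrix (Fin p) (Fin q) ℕ) where
  d : Fin q → ℕ
  d_pos : ∀ k, 0 < d k
  A : MultiMatSubalgebra d n
  B : MultiMatSubalgebra d m
  C : MultiMatSubalgebra d p
  hAB : A.alg ≤ B.alg
  hAC : A.alg ≤ C.alg
  inclAB : HasInclusionMatrix (A.incl B hAB) G
  inclBD : HasInclusionMatrix B.toAmbient H
  inclAC : HasInclusionMatrix (A.incl C hAC) K
  inclCD : HasInclusionMatrix C.toAmbient L
  tr : MultiMat d →ₗ[ℂ] ℂ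
  tr_state : IsFaithfulTracialState tr
  EA : MultiMat d →ₗ[ℂ] MultiMat d
  EB : MultiMat d →ₗ[ℂ] MultiMat d
  EC : MultiMat d →ₗ[ℂ] MultiMat d
  condExpA : IsTraceCondExp tr A.alg EA
  condExpB : IsTraceCondExp tr B.alg EB
  condExpC : IsTraceCondExp tr C.alg EC
  comm_left : EB ∘ₗ EC = EA
  comm_right : EC ∘ₗ EB = EA

/-- `α, β, γ, δ` are the trace weights on `A, B, C, D` that come from the trace of the square. -/
structure CommutingSquare.HasWeights {n m p q : ℕ}
    {G : Matrix (Fin n) (Fin m) ℕ} {H : Matrix (Fin m) (Fin q) ℕ}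
    {K : Matrix (Fin n) (Fin p) ℕ} {L : Matrix (Fin p) (Fin q) ℕ}
    (S : CommutingSquare G H K L)
    (α : Fin n → ℝ) (β : Fin m → ℝ) (γ : Fin p → ℝ) (δ : Fin q → ℝ) : Prop where
  onA : HasTraceWeights (S.tr ∘ₗ S.A.toAmbient.toAlgHom.toLinearMap) α
  onB : HasTraceWeights (S.tr ∘ₗ S.B.toAmbient.toAlgHom.toLinearMap) β
  onC : HasTraceWeights (S.tr ∘ₗ S.C.toAmbient.toAlgHom.toLinearMap) γ
  onD : HasTraceWeights S.tr δ

/-- Compatible systems of trace weights for the inclusion matrices `G, H, K, L`: the weights of a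
faithful (not necessarily normalized) positive trace on `D`, given by `δ`, and of its restrictions
to `A`, `B`, `C`. -/
structure IsWeightSystem {n m p q : ℕ}
    (G : Matrix (Fin n) (Fin m) ℕ) (H : Matrix (Fin m) (Fin q) ℕ)
    (K : Matrix (Fin n) (Fin p) ℕ) (L : Matrix (Fin p) (Fin q) ℕ)
    (α : Fin n → ℝ) (β : Fin m → ℝ) (γ : Fin p → ℝ) (δ : Fin q → ℝ) : Prop where
  α_pos : ∀ i, 0 < α i
  β_pos : ∀ j, 0 < β j
  γ_pos : ∀ l, 0 < γ l
  δ_pos : ∀ k, 0 < δ k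
  β_eq : ∀ j, β j = ∑ k, (H j k : ℝ) * δ k
  γ_eq : ∀ l, γ l = ∑ k, (L l k : ℝ) * δ k
  α_eq_G : ∀ i, α i = ∑ j, (G i j : ℝ) * β j
  α_eq_K : ∀ i, α i = ∑ l, (K i l : ℝ) * γ l

/-- For matrices `M, N` with entries in `ℕ`, the set of pairs of edges `(y, ε, ζ)` with
`1 ≤ ε ≤ M y`, `1 ≤ ζ ≤ N y`, i.e. the paths of length two through a variable middle vertex `y`,
where `M y` and `N y` are the numbers of edges from `y` to the two fixed end points. -/
abbrev EdgePairs {r : ℕ} (M N : Fin r → ℕ) : Type :=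
  (y : Fin r) × (Fin (M y) × Fin (N y))

/-- A matrix with possibly different row and column index sets is unitary. -/
def IsUnitaryMat {X Y : Type} [Fintype X] [Fintype Y] [DecidableEq X] [DecidableEq Y]
    (w : Matrix X Y ℂ) : Prop :=
  w * wᴴ = 1 ∧ wᴴ * w = 1

/-- The bi-unitary condition for the pair `u = ⨁ u^{(i,k)}`, `v = ⨁ v^{(j,l)}`. The block
`u^{(i,k)}` has rows `(j, ρ, σ)` and columns `(l, φ, ψ)`, and the block `v^{(j,l)}` has rows
`(i, ρ, φ)` and columns `(k, σ, ψ)`, where `ρ, σ, φ, ψ` label the edges between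
`i, j`, between `j, k`, between `i, l` and between `l, k`. -/
structure BiUnitary {n m p q : ℕ}
    (G : Matrix (Fin n) (Fin m) ℕ) (H : Matrix (Fin m) (Fin q) ℕ)
    (K : Matrix (Fin n) (Fin p) ℕ) (L : Matrix (Fin p) (Fin q) ℕ)
    (α : Fin n → ℝ) (β : Fin m → ℝ) (γ : Fin p → ℝ) (δ : Fin q → ℝ)
    (u : (i : Fin n) → (k : Fin q) →
      Matrix (EdgePairs (fun j => G i j) (fun j => H j k))
        (EdgePairs (fun l => K i l) (fun l => L l k)) ℂ)
    (v : (j : Fin m) → (l : Fin p) →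
      Matrix (EdgePairs (fun i => G i j) (fun i => K i l))
        (EdgePairs (fun k => H j k) (fun k => L l k)) ℂ) : Prop where
  unitary_u : ∀ i k, IsUnitaryMat (u i k)
  unitary_v : ∀ j l, IsUnitaryMat (v j l)
  relation : ∀ (i : Fin n) (j : Fin m) (k : Fin q) (l : Fin p)
    (ρ : Fin (G i j)) (σ : Fin (H j k)) (φ : Fin (K i l)) (ψ : Fin (L l k)),
    v j l ⟨i, ρ, φ⟩ ⟨k, σ, ψ⟩ =
      (Real.sqrt (α i * δ k / (β j * γ l)) : ℂ) * u i k ⟨j, ρ, σ⟩ ⟨l, φ, ψ⟩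

/-!
Choose a minimal projection in each summand of `A`, `B`, `C`, written `e_i`, `e_j`, `e_l`, and let
`Tr_k` be the trace of the `k`-th summand of `D`. An inclusion with inclusion matrix `G` is
described by its edges: `e_i` splits in `B` into minimal projections, `G i j` of them equivalent to
`e_j`, and the edges from `i` to `j` become partial isometries with support `e_j` and orthogonal
ranges below `e_i` (`IsEdgeSystem`). Hence the range of `e_i` in the `k`-th summand of `D` has one
orthonormal basis indexed by the paths `i → j → k` and another indexed by the paths `i → l → k`, and
`u i k` is the unitary change of basis between them.

Everything rests on one identity. For edges `ρ : i → j` and `ρ' : i' → j`, realized by `w_ρ` and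
`w_ρ'` in `B`, and edges `φ : i → l` and `φ' : i' → l`, realized by `w_φ` and `w_φ'` in `C`,
`Tr_k (w_ρ' w_ρ⋆ w_φ w_φ'⋆)` is the sum over `σ` and `ψ` of the products
`u^{(i,k)}_{(j,ρ,σ)(l,φ,ψ)} * star u^{(i',k)}_{(j,ρ',σ)(l,φ',ψ)}`. Summing over `k` with the weights
`δ k`, and rescaling as in the bi-unitary condition, turns this into the inner product of the rows
`(i,ρ,φ)` and `(i',ρ',φ')` of `v j l` (`mul_conjTranspose_apply_of_relation`).
On the other hand the square commutes exactly when `tr (b * c) = tr (E_A b * c)` for `b` in `B` and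
`c` in `C`. For `b = w_ρ' w_ρ⋆` and `c = w_φ w_φ'⋆` the right-hand side is `β j * γ l / α i` if
`(i,ρ,φ) = (i',ρ',φ')` and zero otherwise, because `e_i' A e_i` is spanned by `e_i` if `i = i'` and
is zero otherwise. So the commuting square condition amounts to the orthonormality of the rows
of `v`. As `Gᵀ * K = H * Lᵀ`, the matrices `v j l` are square, and so they are unitary
(`CommutingSquare.exists_biUnitary`).

For the converse take `A = ℂⁿ`, and let the summands of `B` and `C` act on the spaces of paths of
length one, and those of `D` on the spaces of paths of length two through `B`. The algebra `C` acts
on the paths through `C`, which `u` identifies with the paths through `B`. The trace on `D` is the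
one with weights `δ`, normalized to a state; this is where the constant `c` comes from. The trace
form represents the trace-preserving conditional expectations (`isTraceCondExp_condCoord`), and the
identity above, read backwards on matrix units, gives the commuting square condition
(`BiUnitary.exists_commutingSquare_of_sum_eq_one`, `exists_commutingSquare`).
-/

/-! ### Projections, matrix units and tracial functionals -/

/-- The columns of `X` are an orthonormal basis of the range of the projection `P`. -/
lemma IsStarProjection.exists_frame {b r : ℕ} {P : Matrix (Fin b) (Fin b) ℂ}
    (hP : IsStarProjection P) (hr : P.rank = r) :
    ∃ X : Matrix (Fin b) (Fin r) ℂ, Xᴴ * X = 1 ∧ X * Xᴴ = P := by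
  have hH : P.IsHermitian := hP.isSelfAdjoint
  have hcard : Fintype.card {i // hH.eigenvalues i ≠ 0} = Fintype.card (Fin r) := by
    rw [← hH.rank_eq_card_non_zero_eigs, hr, Fintype.card_fin]
  let e := (Fintype.equivOfCardEq hcard).symm
  obtain ⟨U, hUU, hUU', hspec⟩ : ∃ U : Matrix (Fin b) (Fin b) ℂ, Uᴴ * U = 1 ∧ U * Uᴴ = 1 ∧
      P = U * Matrix.diagonal (RCLike.ofReal ∘ hH.eigenvalues) * Uᴴ :=
    ⟨hH.eigenvectorUnitary.1, Matrix.mem_unitaryGroup_iff'.1 hH.eigenvectorUnitary.2,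
      Matrix.mem_unitaryGroup_iff.1 hH.eigenvectorUnitary.2, by
        conv_lhs => rw [hH.spectral_theorem, Unitary.conjStarAlgAut_apply]
        rfl⟩
  set D : Matrix (Fin b) (Fin b) ℂ := Matrix.diagonal (RCLike.ofReal ∘ hH.eigenvalues) with hD
  have hDD : D * D = D := by
    have h1 : D = Uᴴ * P * U := by
      rw [hspec]
      simp only [Matrix.mul_assoc, hUU, Matrix.mul_one]
      rw [← Matrix.mul_assoc, hUU, Matrix.one_mul]
    rw [h1]
    calc Uᴴ * P * U * (Uᴴ * P * U) = Uᴴ * P * (U * Uᴴ) * P * U := by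
          simp only [Matrix.mul_assoc]
      _ = Uᴴ * (P * P) * U := by rw [hUU', Matrix.mul_one, Matrix.mul_assoc Uᴴ P P]
      _ = _ := by rw [hP.isIdempotentElem.eq]
  have hev : ∀ i, hH.eigenvalues i ≠ 0 → hH.eigenvalues i = 1 := by
    intro i hi
    have := congrFun (congrFun hDD i) i
    simp only [hD, Matrix.diagonal_mul_diagonal, Matrix.diagonal_apply_eq, Function.comp] at this
    have h2 : hH.eigenvalues i * hH.eigenvalues i = hH.eigenvalues i := by
      exact_mod_cast this
    exact mul_right_cancel₀ hi (by rw [h2, one_mul])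
  refine ⟨U.submatrix id (fun s => (e s).1), ?_, ?_⟩
  · ext s t
    have := congrFun (congrFun hUU (e s).1) (e t).1
    simp only [Matrix.mul_apply, Matrix.conjTranspose_apply, Matrix.submatrix_apply, id] at this ⊢
    rw [this]
    simp [Matrix.one_apply, Subtype.val_inj]
  · ext s t
    have hsum : (U * D * Uᴴ) s t = ∑ i, U s i * (hH.eigenvalues i : ℂ) * star (U t i) := by
      rw [Matrix.mul_apply]
      simp [hD, Matrix.mul_diagonal]
    refine Eq.trans ?_ ((congrFun (congrFun hspec s) t).trans hsum).symm
    simp only [Matrix.mul_apply, Matrix.conjTranspose_apply, Matrix.submatrix_apply, id]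
    rw [e.sum_comp (fun i => U s i.1 * star (U t i.1)),
      ← Finset.sum_subtype (Finset.univ.filter (fun i => hH.eigenvalues i ≠ 0)) (by simp)
        (fun i => U s i * star (U t i)), Finset.sum_filter]
    refine Finset.sum_congr rfl fun i _ => ?_
    split_ifs with h
    · simp [hev i h]
    · rw [not_not] at h
      simp [h]

lemma IsStarProjection.trace_eq_rank {b : ℕ} {P : Matrix (Fin b) (Fin b) ℂ}
    (hP : IsStarProjection P) : P.trace = P.rank := by
  obtain ⟨X, h1, h2⟩ := hP.exists_frame rfl
  rw [← h2, Matrix.trace_mul_comm, h1, h2, Matrix.trace_one, Fintype.card_fin]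

lemma isMinProj_single {r : ℕ} (s : Fin r) : IsMinProj (Matrix.single s s (1 : ℂ)) := by
  have h : IsStarProjection (Matrix.single s s (1 : ℂ)) :=
    ⟨by simp [IsIdempotentElem], by
      simp [IsSelfAdjoint, Matrix.star_eq_conjTranspose, Matrix.conjTranspose_single]⟩
  refine ⟨h, ?_⟩
  have := h.trace_eq_rank
  rw [Matrix.trace_single_eq_same] at this
  exact_mod_cast this.symm

/-- The matrix unit `e_{rs}` of the `i`-th summand. -/
def matUnit {n : ℕ} {a : Fin n → ℕ} (i : Fin n) (r s : Fin (a i)) : MultiMat a :=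
  Pi.single i (Matrix.single r s 1)

section matUnit

variable {n : ℕ} {a : Fin n → ℕ}

lemma star_matUnit (i : Fin n) (r s : Fin (a i)) : star (matUnit i r s) = matUnit i s r := by
  funext j
  obtain rfl | h := eq_or_ne j i
  · simp [matUnit, Matrix.star_eq_conjTranspose, Matrix.conjTranspose_single]
  · simp [matUnit, h]

@[simp] lemma matUnit_mul_matUnit (i : Fin n) (r s t : Fin (a i)) :
    matUnit i r s * matUnit i s t = matUnit i r t := by
  simp [matUnit, ← Pi.single_mul]

lemma matUnit_mul_matUnit_of_ne (i : Fin n) {r s s' t : Fin (a i)} (h : s ≠ s') :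
    matUnit i r s * matUnit i s' t = 0 := by
  simp [matUnit, ← Pi.single_mul, h]

lemma matUnit_mul_mul_matUnit (i : Fin n) (r s t t' : Fin (a i)) (x : MultiMat a) :
    matUnit i r s * x * matUnit i t t' = x i s t • matUnit i r t' := by
  funext j
  obtain rfl | h := eq_or_ne j i
  · simp [matUnit, Matrix.single_mul_mul_single, Matrix.smul_single]
  · simp [matUnit, h]

lemma matUnit_mul_mul_matUnit_of_ne {i j : Fin n} (h : i ≠ j) (r s : Fin (a i)) (t t' : Fin (a j))
    (x : MultiMat a) :
    matUnit i r s * x * matUnit j t t' = 0 := by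
  funext k
  obtain rfl | hk := eq_or_ne k i
  · simp [matUnit, h]
  · simp [matUnit, hk]

lemma eq_sum_matUnit (x : MultiMat a) :
    x = ∑ i, ∑ r, ∑ s, x i r s • matUnit i r s := by
  funext j
  simp only [Finset.sum_apply, Pi.smul_apply]
  rw [Finset.sum_eq_single j]
  · conv_lhs => rw [Matrix.matrix_eq_sum_single (x j)]
    simp [matUnit, Matrix.smul_single]
  · intro i _ h
    simp [matUnit, h.symm]
  · simp

end matUnit

lemma tracial_comp {n m : ℕ} {a : Fin n → ℕ} {b : Fin m → ℕ} {τ : MultiMat b →ₗ[ℂ] ℂ}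
    (hτ : ∀ x y, τ (x * y) = τ (y * x)) (f : MultiMat a →⋆ₐ[ℂ] MultiMat b) (x y : MultiMat a) :
    (τ ∘ₗ f.toAlgHom.toLinearMap) (x * y) = (τ ∘ₗ f.toAlgHom.toLinearMap) (y * x) := by
  change τ (f (x * y)) = τ (f (y * x))
  rw [map_mul f, map_mul f, hτ]

lemma tracial_apply_of_matUnit {n : ℕ} {a : Fin n → ℕ} {τ : MultiMat a →ₗ[ℂ] ℂ} {w : Fin n → ℝ}
    (hτ : ∀ x y, τ (x * y) = τ (y * x)) (hw : ∀ i r, τ (matUnit i r r) = w i) (x : MultiMat a) :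
    τ x = ∑ i, (w i : ℂ) * (x i).trace := by
  have hoff : ∀ i (r s : Fin (a i)), r ≠ s → τ (matUnit i r s) = 0 := by
    intro i r s h
    rw [← matUnit_mul_matUnit i r r s, hτ, matUnit_mul_matUnit_of_ne i h.symm, map_zero]
  conv_lhs => rw [eq_sum_matUnit x]
  simp only [map_sum, map_smul]
  refine Finset.sum_congr rfl fun i _ => ?_
  rw [Matrix.trace, Finset.mul_sum]
  refine Finset.sum_congr rfl fun r _ => ?_
  rw [Finset.sum_eq_single r]
  · rw [hw, smul_eq_mul, mul_comm, Matrix.diag]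
  · intro s _ h
    rw [hoff i r s h.symm, smul_zero]
  · simp

/-- A tracial functional is the weighted sum of the traces of the summands. -/
lemma HasTraceWeights.apply_eq {n : ℕ} {a : Fin n → ℕ} {τ : MultiMat a →ₗ[ℂ] ℂ} {w : Fin n → ℝ}
    (hw : HasTraceWeights τ w) (hτ : ∀ x y, τ (x * y) = τ (y * x)) (x : MultiMat a) :
    τ x = ∑ i, (w i : ℂ) * (x i).trace :=
  tracial_apply_of_matUnit hτ (fun i r => hw i _ (isMinProj_single r)) x

lemma hasTraceWeights_of_apply_eq {n : ℕ} {a : Fin n → ℕ} {τ : MultiMat a →ₗ[ℂ] ℂ} {w : Fin n → ℝ}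
    (h : ∀ x, τ x = ∑ i, (w i : ℂ) * (x i).trace) : HasTraceWeights τ w := by
  intro i e he
  rw [h, Finset.sum_eq_single i]
  · rw [Pi.single_eq_same, he.1.trace_eq_rank, he.2, Nat.cast_one, mul_one]
  · intro j _ hj
    rw [Pi.single_eq_of_ne hj, Matrix.trace_zero, mul_zero]
  · simp

lemma matUnit_ne_zero {n : ℕ} {a : Fin n → ℕ} (i : Fin n) (r s : Fin (a i)) :
    matUnit i r s ≠ 0 := by
  intro h
  have := congrFun (congrFun (congrFun h i) r) s
  simp [matUnit] at this

/-- A faithful positive tracial functional has positive trace weights. -/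
lemma exists_hasTraceWeights {n : ℕ} {a : Fin n → ℕ} (ha : ∀ i, 0 < a i) {τ : MultiMat a →ₗ[ℂ] ℂ}
    (hτ : ∀ x y, τ (x * y) = τ (y * x)) (hpos : ∀ x, 0 ≤ τ (star x * x))
    (hf : ∀ x, τ (star x * x) = 0 → x = 0) :
    ∃ w : Fin n → ℝ, (∀ i, 0 < w i) ∧ HasTraceWeights τ w := by
  have key : ∀ i r s, τ (matUnit i r r) = τ (matUnit i s s) := by
    intro i r s
    rw [← matUnit_mul_matUnit i r s r, hτ, matUnit_mul_matUnit]
  have hp : ∀ i r, 0 < τ (matUnit i r r) := by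
    intro i r
    have h1 := hpos (matUnit i r r)
    have h2 := mt (hf (matUnit i r r)) (matUnit_ne_zero i r r)
    rw [star_matUnit, matUnit_mul_matUnit] at h1 h2
    exact lt_of_le_of_ne h1 (Ne.symm h2)
  refine ⟨fun i => (τ (matUnit i ⟨0, ha i⟩ ⟨0, ha i⟩)).re, fun i => (Complex.pos_iff.1 (hp i _)).1,
    hasTraceWeights_of_apply_eq (tracial_apply_of_matUnit hτ fun i r => ?_)⟩
  rw [key i r ⟨0, ha i⟩]
  exact Complex.ext rfl (by simpa using (Complex.pos_iff.1 (hp i _)).2.symm)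

lemma isStarProjection_map_single {n m : ℕ} {a : Fin n → ℕ} {b : Fin m → ℕ}
    (f : MultiMat a →⋆ₐ[ℂ] MultiMat b) {i : Fin n} {e : Matrix (Fin (a i)) (Fin (a i)) ℂ}
    (he : IsStarProjection e) (j : Fin m) : IsStarProjection (f (Pi.single i e) j) := by
  constructor
  · have : f (Pi.single i e) * f (Pi.single i e) = f (Pi.single i e) := by
      rw [← map_mul, ← Pi.single_mul, he.isIdempotentElem.eq]
    exact congrFun this j
  · have : star (f (Pi.single i e)) = f (Pi.single i e) := by
      rw [← map_star, ← Pi.single_star, he.isSelfAdjoint.star_eq]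
    exact congrFun this j

/-- The trace weights of a restricted trace are obtained from the inclusion matrix. -/
lemma HasTraceWeights.comp {n m : ℕ} {a : Fin n → ℕ} {b : Fin m → ℕ}
    {f : MultiMat a →⋆ₐ[ℂ] MultiMat b} {G : Matrix (Fin n) (Fin m) ℕ}
    (hG : HasInclusionMatrix f G) {τ : MultiMat b →ₗ[ℂ] ℂ} {w : Fin m → ℝ}
    (hw : HasTraceWeights τ w) (hτ : ∀ x y, τ (x * y) = τ (y * x)) {i : Fin n}
    {e : Matrix (Fin (a i)) (Fin (a i)) ℂ} (he : IsMinProj e) :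
    τ (f (Pi.single i e)) = ((∑ j, (G i j : ℝ) * w j : ℝ) : ℂ) := by
  rw [hw.apply_eq hτ]
  push_cast
  refine Finset.sum_congr rfl fun j _ => ?_
  rw [(isStarProjection_map_single f he.1 j).trace_eq_rank, hG i e he j, mul_comm]

/-! ### From a commuting square to a bi-unitary pair -/

/-- Elements `w i j ρ` of the middle algebra realizing the edges of an inclusion `f` as partial
isometries: the support projection of `w i j ρ` is the minimal projection `e_j` of the target, and
for fixed `i` the range projections of the `w i j ρ` add up to the image of the minimal projection
`e_i` of the source. -/
structure IsEdgeSystem {n m : ℕ} {a : Fin n → ℕ} {b : Fin m → ℕ} (a₀ : ∀ i, Fin (a i))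
    (b₀ : ∀ j, Fin (b j)) (f : MultiMat a →⋆ₐ[ℂ] MultiMat b) (G : Matrix (Fin n) (Fin m) ℕ)
    (w : (i : Fin n) → (j : Fin m) → Fin (G i j) → MultiMat b) : Prop where
  star_mul : ∀ i j ρ ρ', star (w i j ρ) * w i j ρ' =
    if ρ = ρ' then matUnit j (b₀ j) (b₀ j) else 0
  star_mul_of_ne : ∀ i i' j j' ρ ρ', j ≠ j' → star (w i j ρ) * w i' j' ρ' = 0
  mul_unit : ∀ i j ρ, w i j ρ * matUnit j (b₀ j) (b₀ j) = w i j ρ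
  sum_mul_star : ∀ i, ∑ j, ∑ ρ, w i j ρ * star (w i j ρ) = f (matUnit i (a₀ i) (a₀ i))

/-- The `G i j` edges from `i` to `j` index an orthonormal basis of the range, in the `j`-th
summand, of the image of a minimal projection of the `i`-th summand. -/
lemma HasInclusionMatrix.exists_frame {n m : ℕ} {a : Fin n → ℕ} {b : Fin m → ℕ}
    {f : MultiMat a →⋆ₐ[ℂ] MultiMat b} {G : Matrix (Fin n) (Fin m) ℕ}
    (hf : HasInclusionMatrix f G) (i : Fin n) (r : Fin (a i)) (j : Fin m) :
    ∃ X : Matrix (Fin (b j)) (Fin (G i j)) ℂ, Xᴴ * X = 1 ∧ X * Xᴴ = f (matUnit i r r) j :=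
  (isStarProjection_map_single f (isMinProj_single r).1 j).exists_frame
    (hf i _ (isMinProj_single r) j)

lemma exists_isEdgeSystem {n m : ℕ} {a : Fin n → ℕ} {b : Fin m → ℕ} (a₀ : ∀ i, Fin (a i))
    (b₀ : ∀ j, Fin (b j)) {f : MultiMat a →⋆ₐ[ℂ] MultiMat b} {G : Matrix (Fin n) (Fin m) ℕ}
    (hf : HasInclusionMatrix f G) : ∃ w, IsEdgeSystem a₀ b₀ f G w := by
  choose X hX hX' using fun i => hf.exists_frame i (a₀ i)
  -- `W i j ρ` maps the chosen unit vector of the `j`-th summand to the `ρ`-th basis vector of the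
  -- range of the image of `e_i`, and kills its complement.
  let W : (i : Fin n) → (j : Fin m) → Fin (G i j) → Matrix (Fin (b j)) (Fin (b j)) ℂ :=
    fun i j ρ => Matrix.vecMulVec (fun s => X i j s ρ) (Pi.single (b₀ j) 1)
  have hW : ∀ i j ρ, star (W i j ρ) = Matrix.vecMulVec (Pi.single (b₀ j) 1)
      (star fun s => X i j s ρ) := by
    intro i j ρ
    ext s t
    by_cases h : s = b₀ j <;> simp [W, Matrix.vecMulVec_apply, h]
  have hstar : ∀ i j ρ, star (Pi.single j (W i j ρ) : MultiMat b) = Pi.single j (star (W i j ρ)) :=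
    fun i j ρ => (Pi.single_star ..).symm
  refine ⟨fun i j ρ => Pi.single j (W i j ρ), ?_, ?_, ?_, ?_⟩
  · intro i j ρ ρ'
    rw [hstar, ← Pi.single_mul, hW, Matrix.vecMulVec_mul_vecMulVec]
    have : (star fun s => X i j s ρ) ⬝ᵥ (fun s => X i j s ρ') = if ρ = ρ' then 1 else 0 := by
      have := congrFun (congrFun (hX i j) ρ) ρ'
      rwa [Matrix.one_apply] at this
    rw [this]
    split_ifs
    · simp only [one_smul, matUnit]
      congr 1
      rw [Matrix.single_eq_single_vecMulVec_single]
    · simp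
  · intro i i' j j' ρ ρ' h
    rw [hstar]
    funext k
    obtain rfl | hk := eq_or_ne k j
    · simp [h]
    · simp [hk]
  · intro i j ρ
    rw [matUnit, ← Pi.single_mul, Matrix.single_eq_single_vecMulVec_single,
      Matrix.vecMulVec_mul_vecMulVec]
    simp [W]
  · intro i
    conv_rhs => rw [← Finset.univ_sum_single (f (matUnit i (a₀ i) (a₀ i)))]
    refine Finset.sum_congr rfl fun j _ => ?_
    simp only [hstar, ← Pi.single_mul]
    rw [← hX' i j]
    refine Eq.trans (map_sum (AddMonoidHom.single
      (fun j => Matrix (Fin (b j)) (Fin (b j)) ℂ) j) _ _).symm (congrArg (Pi.single j) ?_)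
    ext s t
    simp [hW, W, Matrix.vecMulVec_mul_vecMulVec, Matrix.sum_apply, Matrix.mul_apply,
      Matrix.vecMulVec_apply]

lemma IsEdgeSystem.map_unit_mul {n m : ℕ} {a : Fin n → ℕ} {b : Fin m → ℕ} {a₀ : ∀ i, Fin (a i)}
    {b₀ : ∀ j, Fin (b j)} {f : MultiMat a →⋆ₐ[ℂ] MultiMat b} {G : Matrix (Fin n) (Fin m) ℕ}
    {w : (i : Fin n) → (j : Fin m) → Fin (G i j) → MultiMat b} (hw : IsEdgeSystem a₀ b₀ f G w)
    (i : Fin n) (j : Fin m) (ρ : Fin (G i j)) :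
    f (matUnit i (a₀ i) (a₀ i)) * w i j ρ = w i j ρ := by
  rw [← hw.sum_mul_star, Finset.sum_mul, Finset.sum_eq_single j]
  · rw [Finset.sum_mul, Finset.sum_eq_single ρ]
    · rw [mul_assoc, hw.star_mul, if_pos rfl, hw.mul_unit]
    · intro ρ' _ h
      rw [mul_assoc, hw.star_mul, if_neg h, mul_zero]
    · simp
  · intro j' _ h
    rw [Finset.sum_mul]
    exact Finset.sum_eq_zero fun ρ' _ => by
      rw [mul_assoc, hw.star_mul_of_ne _ _ _ _ _ _ h, mul_zero]
  · simp

/-- For a two-step inclusion, the paths of length two from `i` to `k` index an orthonormal basis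
(the columns of `Ξ i k`) of the range of the image of `e_i` in the `k`-th summand. -/
lemma IsEdgeSystem.exists_path_frame {n m q : ℕ} {a : Fin n → ℕ} {b : Fin m → ℕ} {d : Fin q → ℕ}
    {a₀ : ∀ i, Fin (a i)} {b₀ : ∀ j, Fin (b j)} {f : MultiMat a →⋆ₐ[ℂ] MultiMat b}
    {G : Matrix (Fin n) (Fin m) ℕ}
    {w : (i : Fin n) → (j : Fin m) → Fin (G i j) → MultiMat b} (hw : IsEdgeSystem a₀ b₀ f G w)
    {g : MultiMat b →⋆ₐ[ℂ] MultiMat d} {H : Matrix (Fin m) (Fin q) ℕ}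
    (hg : HasInclusionMatrix g H) :
    ∃ Ξ : (i : Fin n) → (k : Fin q) →
        Matrix (Fin (d k)) (EdgePairs (fun j => G i j) (fun j => H j k)) ℂ,
      (∀ i k, (Ξ i k)ᴴ * Ξ i k = 1) ∧
      (∀ i k, Ξ i k * (Ξ i k)ᴴ = g (f (matUnit i (a₀ i) (a₀ i))) k) ∧
      ∀ i i' j k (ρ : Fin (G i j)) (ρ' : Fin (G i' j)) s t,
        ∑ σ, Ξ i k s ⟨j, ρ, σ⟩ * star (Ξ i' k t ⟨j, ρ', σ⟩) =
          g (w i j ρ * star (w i' j ρ')) k s t := by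
  choose Y hY hY' using fun j => hg.exists_frame j (b₀ j)
  let Ξ : (i : Fin n) → (k : Fin q) →
        Matrix (Fin (d k)) (EdgePairs (fun j => G i j) (fun j => H j k)) ℂ :=
    fun i k => Matrix.of fun s y => (g (w i y.1 y.2.1) k * Y y.1 k) s y.2.2
  have h3 : ∀ i i' j k (ρ : Fin (G i j)) (ρ' : Fin (G i' j)) s t,
        ∑ σ, Ξ i k s ⟨j, ρ, σ⟩ * star (Ξ i' k t ⟨j, ρ', σ⟩) =
          g (w i j ρ * star (w i' j ρ')) k s t := by
    intro i i' j k ρ ρ' s t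
    have : g (w i j ρ * star (w i' j ρ')) k =
        (g (w i j ρ) k * Y j k) * (g (w i' j ρ') k * Y j k)ᴴ := by
      rw [Matrix.conjTranspose_mul, Matrix.mul_assoc, ← Matrix.mul_assoc (Y j k), hY',
        ← Matrix.mul_assoc, ← hw.mul_unit i j ρ, mul_assoc, map_mul, map_mul, hw.mul_unit,
        map_star]
      simp [Matrix.mul_assoc, Matrix.star_eq_conjTranspose]
    rw [this, Matrix.mul_apply]
    rfl
  have hgram : ∀ i j j' k ρ ρ', (g (w i j ρ) k * Y j k)ᴴ * (g (w i j' ρ') k * Y j' k) =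
      (Y j k)ᴴ * g (star (w i j ρ) * w i j' ρ') k * Y j' k := by
    intro i j j' k ρ ρ'
    rw [Matrix.conjTranspose_mul, map_mul, map_star]
    simp [Matrix.mul_assoc, Matrix.star_eq_conjTranspose]
  refine ⟨Ξ, ?_, ?_, h3⟩
  · intro i k
    ext ⟨j, ρ, σ⟩ ⟨j', ρ', σ'⟩
    have h1 : ((Ξ i k)ᴴ * Ξ i k) ⟨j, ρ, σ⟩ ⟨j', ρ', σ'⟩ =
        ((g (w i j ρ) k * Y j k)ᴴ * (g (w i j' ρ') k * Y j' k)) σ σ' := rfl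
    rw [h1, hgram]
    obtain rfl | hj := eq_or_ne j j'
    · rw [hw.star_mul]
      split_ifs with h
      · subst h
        rw [← hY', Matrix.mul_assoc, Matrix.mul_assoc, hY, Matrix.mul_one, hY]
        simp [Matrix.one_apply]
      · simp [h]
    · rw [hw.star_mul_of_ne _ _ _ _ _ _ hj]
      simp [hj]
  · intro i k
    ext s t
    rw [← hw.sum_mul_star, map_sum, Finset.sum_apply, Matrix.sum_apply, Matrix.mul_apply,
      Fintype.sum_sigma]
    refine Finset.sum_congr rfl fun j _ => ?_
    rw [map_sum, Finset.sum_apply, Matrix.sum_apply, Fintype.sum_prod_type]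
    refine Finset.sum_congr rfl fun ρ _ => ?_
    rw [← h3]
    rfl

lemma MultiMatSubalgebra.toAmbient_incl {n m q : ℕ} {d : Fin q → ℕ} (A : MultiMatSubalgebra d n)
    (B : MultiMatSubalgebra d m) (h : A.alg ≤ B.alg) (x : MultiMat A.dim) :
    B.toAmbient (A.incl B h x) = A.toAmbient x := by
  simp [MultiMatSubalgebra.toAmbient, MultiMatSubalgebra.incl]

lemma MultiMatSubalgebra.toAmbient_mem {q n : ℕ} {d : Fin q → ℕ} (A : MultiMatSubalgebra d n)
    (x : MultiMat A.dim) : A.toAmbient x ∈ A.alg := by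
  simp [MultiMatSubalgebra.toAmbient]

lemma MultiMatSubalgebra.exists_toAmbient_eq {q n : ℕ} {d : Fin q → ℕ} (A : MultiMatSubalgebra d n)
    {x : MultiMat d} (hx : x ∈ A.alg) : ∃ z, A.toAmbient z = x :=
  ⟨A.iso.symm ⟨x, hx⟩, by simp [MultiMatSubalgebra.toAmbient]⟩

lemma MultiMatSubalgebra.toAmbient_injective {q n : ℕ} {d : Fin q → ℕ}
    (A : MultiMatSubalgebra d n) : Function.Injective A.toAmbient := by
  intro x y h
  simpa [MultiMatSubalgebra.toAmbient] using h

/-- The relation between `u` and `v` expresses the inner product of two rows of `v` through the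
weighted inner products of entries of `u`. -/
lemma mul_conjTranspose_apply_of_relation {n m p q : ℕ} {G : Matrix (Fin n) (Fin m) ℕ}
    {H : Matrix (Fin m) (Fin q) ℕ} {K : Matrix (Fin n) (Fin p) ℕ} {L : Matrix (Fin p) (Fin q) ℕ}
    {α : Fin n → ℝ} {β : Fin m → ℝ} {γ : Fin p → ℝ} {δ : Fin q → ℝ}
    {u : (i : Fin n) → (k : Fin q) →
      Matrix (EdgePairs (fun j => G i j) (fun j => H j k))
        (EdgePairs (fun l => K i l) (fun l => L l k)) ℂ}
    {v : (j : Fin m) → (l : Fin p) →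
      Matrix (EdgePairs (fun i => G i j) (fun i => K i l))
        (EdgePairs (fun k => H j k) (fun k => L l k)) ℂ}
    (hα : ∀ i, 0 ≤ α i) (hβ : ∀ j, 0 ≤ β j) (hγ : ∀ l, 0 ≤ γ l) (hδ : ∀ k, 0 ≤ δ k)
    (hrel : ∀ (i : Fin n) (j : Fin m) (k : Fin q) (l : Fin p)
      (ρ : Fin (G i j)) (σ : Fin (H j k)) (φ : Fin (K i l)) (ψ : Fin (L l k)),
      v j l ⟨i, ρ, φ⟩ ⟨k, σ, ψ⟩ =
        (Real.sqrt (α i * δ k / (β j * γ l)) : ℂ) * u i k ⟨j, ρ, σ⟩ ⟨l, φ, ψ⟩)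
    (j : Fin m) (l : Fin p) (i i' : Fin n) (ρ : Fin (G i j)) (ρ' : Fin (G i' j))
    (φ : Fin (K i l)) (φ' : Fin (K i' l)) :
    (v j l * (v j l)ᴴ) ⟨i, ρ, φ⟩ ⟨i', ρ', φ'⟩ =
      ((Real.sqrt (α i * α i') / (β j * γ l) : ℝ) : ℂ) * ∑ k, (δ k : ℂ) *
        ∑ σ, ∑ ψ, u i k ⟨j, ρ, σ⟩ ⟨l, φ, ψ⟩ * star (u i' k ⟨j, ρ', σ⟩ ⟨l, φ', ψ⟩) := by
  have hsqrt : ∀ k, Real.sqrt (α i * δ k / (β j * γ l)) * Real.sqrt (α i' * δ k / (β j * γ l)) =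
      Real.sqrt (α i * α i') / (β j * γ l) * δ k := by
    intro k
    have h1 : 0 ≤ δ k / (β j * γ l) := div_nonneg (hδ k) (mul_nonneg (hβ j) (hγ l))
    rw [mul_div_assoc, mul_div_assoc, ← Real.sqrt_mul (mul_nonneg (hα i) h1),
      mul_mul_mul_comm, Real.sqrt_mul' _ (mul_self_nonneg _), Real.sqrt_mul_self h1]
    ring
  rw [Finset.mul_sum, Matrix.mul_apply, Fintype.sum_sigma]
  refine Finset.sum_congr rfl fun k _ => ?_
  rw [← mul_assoc, ← Complex.ofReal_mul, ← hsqrt, Fintype.sum_prod_type, Finset.mul_sum]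
  refine Finset.sum_congr rfl fun σ _ => ?_
  rw [Finset.mul_sum]
  refine Finset.sum_congr rfl fun ψ _ => ?_
  rw [Matrix.conjTranspose_apply, hrel, hrel, star_mul', Complex.ofReal_mul, Complex.star_def,
    Complex.conj_ofReal]
  ring

namespace CommutingSquare

variable {n m p q : ℕ} {G : Matrix (Fin n) (Fin m) ℕ} {H : Matrix (Fin m) (Fin q) ℕ}
  {K : Matrix (Fin n) (Fin p) ℕ} {L : Matrix (Fin p) (Fin q) ℕ} (S : CommutingSquare G H K L)

/-- In a commuting square, `E_C b = E_C (E_B b) = E_A b` for `b` in `B`. -/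
lemma tr_mul_eq {b c : MultiMat S.d} (hb : b ∈ S.B.alg) (hc : c ∈ S.C.alg) :
    S.tr (b * c) = S.tr (S.EA b * c) := by
  have h := S.condExpC.bimodule 1 (one_mem _) c hc b
  rw [one_mul, one_mul] at h
  rw [← S.condExpC.preserves (b * c), h, ← S.comm_right, LinearMap.comp_apply,
    S.condExpB.apply_of_mem b hb]

/-- The commuting square condition, tested on elements `b ∈ e_{i'} B e_i` and `c ∈ e_i C` for
minimal projections `e_i`, `e_{i'}` of `A`: since `e_{i'} A e_i` is zero or spanned by `e_i`, the
conditional expectation of `b` onto `A` is a multiple of `e_i`. -/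
lemma tr_mul_eq_of_corner {α : Fin n → ℝ}
    (hα : HasTraceWeights (S.tr ∘ₗ S.A.toAmbient.toAlgHom.toLinearMap) α)
    (a₀ : ∀ i, Fin (S.A.dim i)) {i i' : Fin n} {b c : MultiMat S.d} (hb : b ∈ S.B.alg)
    (hc : c ∈ S.C.alg) (hb1 : S.A.toAmbient (matUnit i' (a₀ i') (a₀ i')) * b = b)
    (hb2 : b * S.A.toAmbient (matUnit i (a₀ i) (a₀ i)) = b)
    (hc1 : S.A.toAmbient (matUnit i (a₀ i) (a₀ i)) * c = c) :
    S.tr (b * c) * α i = if i = i' then S.tr b * S.tr c else 0 := by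
  obtain ⟨z, hz⟩ := S.A.exists_toAmbient_eq (S.condExpA.mem b)
  have hE : S.EA b = S.A.toAmbient
      (matUnit i' (a₀ i') (a₀ i') * z * matUnit i (a₀ i) (a₀ i)) := by
    rw [map_mul, map_mul, hz, ← S.condExpA.bimodule _ (S.A.toAmbient_mem _) _
      (S.A.toAmbient_mem _), hb1, hb2]
  rw [S.tr_mul_eq hb hc]
  split_ifs with h
  · subst h
    have hαi : S.tr (S.A.toAmbient (matUnit i (a₀ i) (a₀ i))) = α i :=
      hα i _ (isMinProj_single _)
    rw [matUnit_mul_mul_matUnit, map_smul] at hE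
    rw [← S.condExpA.preserves b, hE, smul_mul_assoc, hc1, map_smul, map_smul, hαi, smul_eq_mul,
      smul_eq_mul]
    ring
  · rw [hE, matUnit_mul_mul_matUnit_of_ne (Ne.symm h)]
    simp

/-- The bi-unitary pair of a commuting square. The block `u i k` is the change of basis between the
two bases of `e_i D e_k` given by the paths through `B` and through `C`. The block `v j l` is, up to
normalization, the change of basis in `e_j D e_l` between the elements built from edges `j → k ← l`
and those built from edges `j ← i → l`; the commuting square condition says that the latter are
orthogonal. -/
theorem exists_biUnitary (hGK : Gᵀ * K = H * Lᵀ) {α : Fin n → ℝ} {β : Fin m → ℝ} {γ : Fin p → ℝ}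
    {δ : Fin q → ℝ} (hS : S.HasWeights α β γ δ) (hα : ∀ i, 0 < α i) (hβ : ∀ j, 0 < β j)
    (hγ : ∀ l, 0 < γ l) (hδ : ∀ k, 0 < δ k) : ∃ u v, BiUnitary G H K L α β γ δ u v := by
  let a₀ : ∀ i, Fin (S.A.dim i) := fun i => ⟨0, S.A.dim_pos i⟩
  let b₀ : ∀ j, Fin (S.B.dim j) := fun j => ⟨0, S.B.dim_pos j⟩
  let c₀ : ∀ l, Fin (S.C.dim l) := fun l => ⟨0, S.C.dim_pos l⟩
  obtain ⟨w, hw⟩ := exists_isEdgeSystem a₀ b₀ S.inclAB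
  obtain ⟨w', hw'⟩ := exists_isEdgeSystem a₀ c₀ S.inclAC
  obtain ⟨Ξ, hΞ, hΞ', hΞw⟩ := hw.exists_path_frame S.inclBD
  obtain ⟨Θ, hΘ, hΘ', hΘw⟩ := hw'.exists_path_frame S.inclCD
  simp only [S.A.toAmbient_incl S.B S.hAB] at hΞ'
  simp only [S.A.toAmbient_incl S.C S.hAC] at hΘ'
  let u := fun i k => (Ξ i k)ᴴ * Θ i k
  let v : (j : Fin m) → (l : Fin p) →
      Matrix (EdgePairs (fun i => G i j) (fun i => K i l))
        (EdgePairs (fun k => H j k) (fun k => L l k)) ℂ := fun j l => Matrix.of fun x y =>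
    (Real.sqrt (α x.1 * δ y.1 / (β j * γ l)) : ℂ) *
      u x.1 y.1 ⟨j, x.2.1, y.2.1⟩ ⟨l, x.2.2, y.2.2⟩
  -- The commuting square condition, on products of edges of `B` with edges of `C`.
  have htr : ∀ i i' j l (ρ : Fin (G i j)) (ρ' : Fin (G i' j)) (φ : Fin (K i l)) (φ' : Fin (K i' l)),
      S.tr (S.B.toAmbient (w i' j ρ' * star (w i j ρ)) *
        S.C.toAmbient (w' i l φ * star (w' i' l φ'))) * α i =
      if (⟨i, ρ, φ⟩ : EdgePairs (fun i => G i j) (fun i => K i l)) = ⟨i', ρ', φ'⟩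
        then (β j * γ l : ℂ) else 0 := by
    intro i i' j l ρ ρ' φ φ'
    rw [S.tr_mul_eq_of_corner hS.onA a₀ (i := i) (i' := i') (S.B.toAmbient_mem _)
      (S.C.toAmbient_mem _)]
    · by_cases h : i = i'
      · subst h
        have htrB : S.tr (S.B.toAmbient (matUnit j (b₀ j) (b₀ j))) = β j :=
          hS.onB j _ (isMinProj_single _)
        have htrC : S.tr (S.C.toAmbient (matUnit l (c₀ l) (c₀ l))) = γ l :=
          hS.onC l _ (isMinProj_single _)
        have h1 : S.tr (S.B.toAmbient (w i j ρ' * star (w i j ρ))) = if ρ = ρ' then β j else 0 := by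
          rw [map_mul, S.tr_state.tracial, ← map_mul, hw.star_mul]
          split_ifs <;> simp [htrB]
        have h2 : S.tr (S.C.toAmbient (w' i l φ * star (w' i l φ'))) =
            if φ' = φ then γ l else 0 := by
          rw [map_mul, S.tr_state.tracial, ← map_mul, hw'.star_mul]
          split_ifs <;> simp [htrC]
        rw [if_pos rfl, h1, h2]
        by_cases hρ : ρ = ρ'
        · subst hρ
          by_cases hφ : φ = φ'
          · subst hφ
            simp
          · have : φ' ≠ φ := Ne.symm hφ
            simp [hφ, this]
        · simp [hρ]
      · simp [h]
    · rw [← S.A.toAmbient_incl S.B S.hAB, ← map_mul, ← mul_assoc, hw.map_unit_mul]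
    · have := congrArg star (hw.map_unit_mul i j ρ)
      rw [StarMul.star_mul, ← map_star, star_matUnit] at this
      rw [← S.A.toAmbient_incl S.B S.hAB, ← map_mul, mul_assoc, this]
    · rw [← S.A.toAmbient_incl S.C S.hAC, ← map_mul, ← mul_assoc, hw'.map_unit_mul]
  -- The same products in the bases given by paths.
  have hsum : ∀ i i' j l (ρ : Fin (G i j)) (ρ' : Fin (G i' j)) (φ : Fin (K i l)) (φ' : Fin (K i' l))
      k, ∑ σ, ∑ ψ, u i k ⟨j, ρ, σ⟩ ⟨l, φ, ψ⟩ * star (u i' k ⟨j, ρ', σ⟩ ⟨l, φ', ψ⟩) =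
      ((S.B.toAmbient (w i' j ρ' * star (w i j ρ)) *
        S.C.toAmbient (w' i l φ * star (w' i' l φ'))) k).trace := by
    intro i i' j l ρ ρ' φ φ' k
    simp only [Pi.mul_apply, Matrix.trace, Matrix.diag, Matrix.mul_apply, ← hΞw, ← hΘw,
      Finset.sum_mul_sum, u, star_sum, Matrix.conjTranspose_apply, star_mul', star_star]
    calc _ = ∑ σ, ∑ ψ, ∑ t, ∑ s, star (Ξ i k s ⟨j, ρ, σ⟩) * Θ i k s ⟨l, φ, ψ⟩ *
          (Ξ i' k t ⟨j, ρ', σ⟩ * star (Θ i' k t ⟨l, φ', ψ⟩)) :=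
          Finset.sum_congr rfl fun σ _ => Finset.sum_congr rfl fun ψ _ => Finset.sum_comm
      _ = ∑ σ, ∑ t, ∑ s, ∑ ψ, star (Ξ i k s ⟨j, ρ, σ⟩) * Θ i k s ⟨l, φ, ψ⟩ *
          (Ξ i' k t ⟨j, ρ', σ⟩ * star (Θ i' k t ⟨l, φ', ψ⟩)) :=
          Finset.sum_congr rfl fun σ _ => by
            rw [Finset.sum_comm]
            exact Finset.sum_congr rfl fun t _ => Finset.sum_comm
      _ = ∑ t, ∑ s, ∑ σ, ∑ ψ, star (Ξ i k s ⟨j, ρ, σ⟩) * Θ i k s ⟨l, φ, ψ⟩ *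
          (Ξ i' k t ⟨j, ρ', σ⟩ * star (Θ i' k t ⟨l, φ', ψ⟩)) := by
            rw [Finset.sum_comm]
            exact Finset.sum_congr rfl fun t _ => Finset.sum_comm
      _ = _ := by
            refine Finset.sum_congr rfl fun t _ => Finset.sum_congr rfl fun s _ =>
              Finset.sum_congr rfl fun σ _ => Finset.sum_congr rfl fun ψ _ => ?_
            ring
  have hvv : ∀ j l, v j l * (v j l)ᴴ = 1 := by
    intro j l
    ext ⟨i, ρ, φ⟩ ⟨i', ρ', φ'⟩
    have hent := mul_conjTranspose_apply_of_relation (α := α) (β := β) (γ := γ) (δ := δ) (u := u)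
      (v := v) (fun i => (hα i).le) (fun j => (hβ j).le) (fun l => (hγ l).le) (fun k => (hδ k).le)
      (fun _ _ _ _ _ _ _ _ => rfl) j l i i' ρ ρ' φ φ'
    simp only [hsum] at hent
    rw [← hS.onD.apply_eq S.tr_state.tracial] at hent
    have hαi : (α i : ℂ) ≠ 0 := by exact_mod_cast (hα i).ne'
    have ht := htr i i' j l ρ ρ' φ φ'
    rw [hent, Matrix.one_apply]
    split_ifs at ht ⊢ with h
    · obtain ⟨rfl, h2⟩ := Sigma.mk.inj_iff.1 h
      have hβ' : (β j : ℂ) ≠ 0 := by exact_mod_cast (hβ j).ne'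
      have hγ' : (γ l : ℂ) ≠ 0 := by exact_mod_cast (hγ l).ne'
      rw [eq_div_of_mul_eq hαi ht, Real.sqrt_mul_self (hα i).le]
      push_cast
      field_simp
    · rw [(mul_eq_zero.1 ht).resolve_right hαi, mul_zero]
  refine ⟨u, v, ?_, ?_, fun _ _ _ _ _ _ _ _ => rfl⟩
  · intro i k
    constructor
    · calc (Ξ i k)ᴴ * Θ i k * ((Ξ i k)ᴴ * Θ i k)ᴴ = (Ξ i k)ᴴ * (Θ i k * (Θ i k)ᴴ) * Ξ i k := by
            simp [Matrix.mul_assoc]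
        _ = ((Ξ i k)ᴴ * Ξ i k) * ((Ξ i k)ᴴ * Ξ i k) := by
            rw [hΘ', ← hΞ']
            simp only [Matrix.mul_assoc]
        _ = 1 := by rw [hΞ, Matrix.one_mul]
    · calc ((Ξ i k)ᴴ * Θ i k)ᴴ * ((Ξ i k)ᴴ * Θ i k) = (Θ i k)ᴴ * (Ξ i k * (Ξ i k)ᴴ) * Θ i k := by
            simp [Matrix.mul_assoc]
        _ = ((Θ i k)ᴴ * Θ i k) * ((Θ i k)ᴴ * Θ i k) := by
            rw [hΞ', ← hΘ']
            simp only [Matrix.mul_assoc]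
        _ = 1 := by rw [hΘ, Matrix.one_mul]
  · intro j l
    refine ⟨hvv j l, (Matrix.mul_eq_one_comm_of_card_eq _ _ _ ?_).1 (hvv j l)⟩
    have := congrFun (congrFun hGK j) l
    simpa [Matrix.mul_apply, Fintype.card_sigma] using this

end CommutingSquare

/-- The trace weights on the four algebras of a commuting square form a weight system. -/
lemma CommutingSquare.exists_hasWeights {n m p q : ℕ} {G : Matrix (Fin n) (Fin m) ℕ}
    {H : Matrix (Fin m) (Fin q) ℕ} {K : Matrix (Fin n) (Fin p) ℕ} {L : Matrix (Fin p) (Fin q) ℕ}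
    (S : CommutingSquare G H K L) :
    ∃ (α : Fin n → ℝ) (β : Fin m → ℝ) (γ : Fin p → ℝ) (δ : Fin q → ℝ),
      IsWeightSystem G H K L α β γ δ ∧ S.HasWeights α β γ δ := by
  have key : ∀ {r : ℕ} (X : MultiMatSubalgebra S.d r), ∃ w : Fin r → ℝ, (∀ i, 0 < w i) ∧
      HasTraceWeights (S.tr ∘ₗ X.toAmbient.toAlgHom.toLinearMap) w := by
    intro r X
    refine exists_hasTraceWeights X.dim_pos (tracial_comp S.tr_state.tracial _) ?_ ?_
    · intro x
      change 0 ≤ S.tr (X.toAmbient (star x * x))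
      rw [map_mul, map_star]
      exact S.tr_state.nonneg _
    · intro x hx
      change S.tr (X.toAmbient (star x * x)) = 0 at hx
      rw [map_mul, map_star] at hx
      exact X.toAmbient_injective ((S.tr_state.faithful _ hx).trans (map_zero _).symm)
  obtain ⟨α, hα, hα'⟩ := key S.A
  obtain ⟨β, hβ, hβ'⟩ := key S.B
  obtain ⟨γ, hγ, hγ'⟩ := key S.C
  obtain ⟨δ, hδ, hδ'⟩ := exists_hasTraceWeights S.d_pos S.tr_state.tracial S.tr_state.nonneg
    S.tr_state.faithful
  refine ⟨α, β, γ, δ, ⟨hα, hβ, hγ, hδ, fun j => ?_, fun l => ?_, fun i => ?_, fun i => ?_⟩,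
    ⟨hα', hβ', hγ', hδ'⟩⟩
  · have h := isMinProj_single (⟨0, S.B.dim_pos j⟩ : Fin (S.B.dim j))
    exact Complex.ofReal_injective ((hβ' j _ h).symm.trans (hδ'.comp S.inclBD S.tr_state.tracial h))
  · have h := isMinProj_single (⟨0, S.C.dim_pos l⟩ : Fin (S.C.dim l))
    exact Complex.ofReal_injective ((hγ' l _ h).symm.trans (hδ'.comp S.inclCD S.tr_state.tracial h))
  · have h := isMinProj_single (⟨0, S.A.dim_pos i⟩ : Fin (S.A.dim i))
    refine Complex.ofReal_injective ((hα' i _ h).symm.trans (Eq.trans ?_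
      (hβ'.comp S.inclAB (tracial_comp S.tr_state.tracial _) h)))
    exact congrArg S.tr (S.A.toAmbient_incl S.B S.hAB _).symm
  · have h := isMinProj_single (⟨0, S.A.dim_pos i⟩ : Fin (S.A.dim i))
    refine Complex.ofReal_injective ((hα' i _ h).symm.trans (Eq.trans ?_
      (hγ'.comp S.inclAC (tracial_comp S.tr_state.tracial _) h)))
    exact congrArg S.tr (S.A.toAmbient_incl S.C S.hAC _).symm

/-! ### Trace-preserving conditional expectations -/

/-- The trace-preserving conditional expectation onto the range of `f`, in the coordinates of the
source of `f`; here `w` are the trace weights of `τ ∘ f`. -/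
noncomputable def condCoord {n q : ℕ} {a : Fin n → ℕ} {d : Fin q → ℕ} (τ : MultiMat d →ₗ[ℂ] ℂ)
    (f : MultiMat a →⋆ₐ[ℂ] MultiMat d) (w : Fin n → ℝ) : MultiMat d →ₗ[ℂ] MultiMat a where
  toFun z := fun i => Matrix.of fun r s => (w i : ℂ)⁻¹ * τ (z * f (matUnit i s r))
  map_add' x y := by
    funext i
    ext r s
    simp [add_mul, mul_add]
  map_smul' c x := by
    funext i
    ext r s
    simp [mul_left_comm]

section condCoord

variable {n q : ℕ} {a : Fin n → ℕ} {d : Fin q → ℕ} {τ : MultiMat d →ₗ[ℂ] ℂ}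
  {f : MultiMat a →⋆ₐ[ℂ] MultiMat d} {w : Fin n → ℝ}

lemma condCoord_apply (z : MultiMat d) (i : Fin n) (r s : Fin (a i)) :
    condCoord τ f w z i r s = (w i : ℂ)⁻¹ * τ (z * f (matUnit i s r)) := rfl

/-- The element `f (condCoord τ f w z)` represents the functional `τ (z * ·)` on the range
of `f`. -/
lemma tr_condCoord_mul (hw : ∀ i, w i ≠ 0) (h : ∀ x, τ (f x) = ∑ i, (w i : ℂ) * (x i).trace)
    (z : MultiMat d) (y : MultiMat a) : τ (f (condCoord τ f w z) * f y) = τ (z * f y) := by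
  rw [← map_mul, h]
  conv_rhs => rw [eq_sum_matUnit y]
  simp only [map_sum, map_smul, Finset.mul_sum, mul_smul_comm]
  refine Finset.sum_congr rfl fun i _ => ?_
  have hwi : (w i : ℂ) ≠ 0 := by exact_mod_cast hw i
  rw [Pi.mul_apply, Matrix.trace, Finset.mul_sum, Finset.sum_comm]
  refine Finset.sum_congr rfl fun r _ => ?_
  rw [Matrix.diag, Matrix.mul_apply, Finset.mul_sum]
  refine Finset.sum_congr rfl fun s _ => ?_
  rw [condCoord_apply, smul_eq_mul]
  field_simp

/-- Nondegeneracy of the trace form on a `*`-subalgebra. -/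
lemma IsFaithfulTracialState.eq_of_forall_tr_mul (hτ : IsFaithfulTracialState τ)
    {X : StarSubalgebra ℂ (MultiMat d)} {x y : MultiMat d} (hx : x ∈ X) (hy : y ∈ X)
    (h : ∀ t ∈ X, τ (x * t) = τ (y * t)) : x = y := by
  rw [← sub_eq_zero]
  refine hτ.faithful _ ?_
  rw [hτ.tracial, sub_mul, map_sub, sub_eq_zero]
  exact h _ (star_mem (sub_mem hx hy))

open scoped MatrixOrder Matrix.Norms.L2Operator in
lemma Matrix.PosSemidef.exists_eq_star_mul_self {r : ℕ} {M : Matrix (Fin r) (Fin r) ℂ}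
    (hM : M.PosSemidef) : ∃ t, M = star t * t :=
  CStarAlgebra.nonneg_iff_eq_star_mul_self.1 hM.nonneg

/-- A `*`-homomorphism is positive. -/
lemma posSemidef_map {x : MultiMat a} (hx : ∀ i, (x i).PosSemidef) (k : Fin q) :
    (f x k).PosSemidef := by
  choose t ht using fun i => (hx i).exists_eq_star_mul_self
  have : x = star t * t := funext ht
  rw [this, map_mul, map_star]
  exact Matrix.posSemidef_conjTranspose_mul_self _

lemma IsFaithfulTracialState.tr_star (hτ : IsFaithfulTracialState τ) {δ : Fin q → ℝ}
    (hδ : HasTraceWeights τ δ) (z : MultiMat d) : τ (star z) = star (τ z) := by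
  rw [hδ.apply_eq hτ.tracial, hδ.apply_eq hτ.tracial, star_sum]
  refine Finset.sum_congr rfl fun k _ => ?_
  rw [star_mul', Pi.star_apply, Matrix.star_eq_conjTranspose, Matrix.trace_conjTranspose,
    Complex.star_def, Complex.conj_ofReal]

lemma posSemidef_condCoord (hτ : IsFaithfulTracialState τ) {δ : Fin q → ℝ}
    (hδ : HasTraceWeights τ δ) (hδ0 : ∀ k, 0 ≤ δ k) (hw : ∀ i, 0 ≤ w i)
    {z : MultiMat d} (hz : ∀ k, (z k).PosSemidef) (i : Fin n) :
    (condCoord τ f w z i).PosSemidef := by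
  refine Matrix.PosSemidef.of_dotProduct_mulVec_nonneg ?_ fun x => ?_
  · ext r s
    have hz' : star z = z := funext fun k => (hz k).isHermitian
    rw [Matrix.conjTranspose_apply, condCoord_apply, condCoord_apply, star_mul',
      ← hτ.tr_star hδ, star_mul, ← map_star f, star_matUnit, hz', hτ.tracial]
    simp
  · obtain _ | hne := isEmpty_or_nonempty (Fin (a i))
    · simp [dotProduct]
    obtain ⟨o⟩ := hne
    -- The quadratic form of the `i`-th component is `τ` of the positive element `f(g)⋆ z f(g)`.
    let g : MultiMat a := ∑ r, x r • matUnit i r o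
    have hg : star x ⬝ᵥ (condCoord τ f w z i) *ᵥ x =
        (w i : ℂ)⁻¹ * τ (star (f g) * z * f g) := by
      have hgg : g * star g = ∑ r, ∑ s, (x r * star (x s)) • matUnit i r s := by
        simp only [g, star_sum, star_smul, star_matUnit, Finset.sum_mul_sum, smul_mul_smul_comm,
          matUnit_mul_matUnit]
      rw [mul_assoc, hτ.tracial, mul_assoc, ← map_star f, ← map_mul f, hgg]
      simp only [map_sum, map_smul, Finset.mul_sum, mul_smul_comm, dotProduct, Matrix.mulVec]
      rw [Finset.sum_comm]
      refine Finset.sum_congr rfl fun r _ => Finset.sum_congr rfl fun s _ => ?_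
      rw [condCoord_apply, Pi.star_apply, smul_eq_mul]
      ring
    rw [hg]
    refine mul_nonneg ?_ ?_
    · rw [← Complex.ofReal_inv]
      exact_mod_cast inv_nonneg.2 (hw i)
    · rw [hδ.apply_eq hτ.tracial]
      refine Finset.sum_nonneg fun k _ => mul_nonneg (by exact_mod_cast hδ0 k) ?_
      exact ((hz k).conjTranspose_mul_mul_same (f g k)).trace_nonneg

/-- The functional `τ (z * ·)` on the range of `f` is represented by a unique element of the range,
and mapping `z` to it is the trace-preserving conditional expectation. -/
lemma isTraceCondExp_condCoord (hτ : IsFaithfulTracialState τ) {δ : Fin q → ℝ}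
    (hδ : HasTraceWeights τ δ) (hδ0 : ∀ k, 0 ≤ δ k) (hw : ∀ i, 0 < w i)
    (h : ∀ x, τ (f x) = ∑ i, (w i : ℂ) * (x i).trace) :
    IsTraceCondExp τ f.range (f.toAlgHom.toLinearMap ∘ₗ condCoord τ f w) := by
  have hmem : ∀ z, f (condCoord τ f w z) ∈ f.range := fun z => ⟨_, rfl⟩
  have htr : ∀ z, ∀ y ∈ f.range, τ (f (condCoord τ f w z) * y) = τ (z * y) := by
    rintro z _ ⟨y, rfl⟩
    exact tr_condCoord_mul (fun i => (hw i).ne') h z y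
  refine ⟨hmem, fun x hx => hτ.eq_of_forall_tr_mul (hmem x) hx fun y hy => htr x y hy, ?_, ?_, ?_⟩
  · intro x hx y hy z
    refine hτ.eq_of_forall_tr_mul (hmem _) (mul_mem (mul_mem hx (hmem z)) hy) fun t ht => ?_
    change τ (f (condCoord τ f w (x * z * y)) * t) = τ (x * f (condCoord τ f w z) * y * t)
    rw [htr _ _ ht]
    simp only [mul_assoc]
    rw [hτ.tracial x, hτ.tracial x]
    simp only [mul_assoc]
    exact (htr z _ (mul_mem hy (mul_mem ht hx))).symm
  · exact fun z hz k => posSemidef_map (posSemidef_condCoord hτ hδ hδ0 (fun i => (hw i).le) hz) k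
  · intro z
    simpa using htr z 1 (one_mem _)

end condCoord

/-! ### Commuting squares from compatible embeddings -/

/-- The image of an injective unital `*`-homomorphism, as a multi-matrix subalgebra. -/
noncomputable def MultiMatSubalgebra.ofInjective {n q : ℕ} {a : Fin n → ℕ} {d : Fin q → ℕ}
    (ha : ∀ i, 0 < a i) (f : MultiMat a →⋆ₐ[ℂ] MultiMat d) (hf : Function.Injective f) :
    MultiMatSubalgebra d n where
  alg := f.range
  dim := a
  dim_pos := ha
  iso := StarAlgEquiv.ofInjective f hf

/-- A `*`-homomorphism along which a functional pulls back to one with positive trace weights is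
injective, since the pulled back functional is faithful. -/
lemma injective_of_trace_weights {n q : ℕ} {a : Fin n → ℕ} {d : Fin q → ℕ}
    {τ : MultiMat d →ₗ[ℂ] ℂ} {f : MultiMat a →⋆ₐ[ℂ] MultiMat d} {w : Fin n → ℝ} (hw : ∀ i, 0 < w i)
    (h : ∀ x, τ (f x) = ∑ i, (w i : ℂ) * (x i).trace) : Function.Injective f := by
  rw [injective_iff_map_eq_zero]
  intro x hx
  have h0 := h (star x * x)
  rw [map_mul, hx, mul_zero, map_zero] at h0
  have hnn : ∀ i, 0 ≤ ((star x * x) i).trace := fun i =>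
    (Matrix.posSemidef_conjTranspose_mul_self (x i)).trace_nonneg
  have hw' : ∀ i, 0 < (w i : ℂ) := fun i => by exact_mod_cast hw i
  funext i
  have := (Finset.sum_eq_zero_iff_of_nonneg
    (fun i _ => mul_nonneg (hw' i).le (hnn i))).1 h0.symm i (Finset.mem_univ i)
  exact Matrix.trace_conjTranspose_mul_self_eq_zero_iff.1
    ((mul_eq_zero.1 this).resolve_left (hw' i).ne')

/-- Compatible embeddings of multi-matrix algebras give a commuting square as soon as `τ (b c)`
depends only on the conditional expectation of `b` onto the smallest algebra. -/
theorem exists_commutingSquare {n m p q : ℕ} {G : Matrix (Fin n) (Fin m) ℕ}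
    {H : Matrix (Fin m) (Fin q) ℕ} {K : Matrix (Fin n) (Fin p) ℕ} {L : Matrix (Fin p) (Fin q) ℕ}
    {a : Fin n → ℕ} {b : Fin m → ℕ} {c : Fin p → ℕ} {d : Fin q → ℕ} (ha : ∀ i, 0 < a i)
    (hb : ∀ j, 0 < b j) (hc : ∀ l, 0 < c l) (hd : ∀ k, 0 < d k)
    {gB : MultiMat a →⋆ₐ[ℂ] MultiMat b} {fB : MultiMat b →⋆ₐ[ℂ] MultiMat d}
    {gC : MultiMat a →⋆ₐ[ℂ] MultiMat c} {fC : MultiMat c →⋆ₐ[ℂ] MultiMat d}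
    (hcomm : ∀ x, fB (gB x) = fC (gC x)) (hG : HasInclusionMatrix gB G)
    (hH : HasInclusionMatrix fB H) (hK : HasInclusionMatrix gC K) (hL : HasInclusionMatrix fC L)
    {τ : MultiMat d →ₗ[ℂ] ℂ} (hτ : IsFaithfulTracialState τ) {α : Fin n → ℝ} {β : Fin m → ℝ}
    {γ : Fin p → ℝ} {δ : Fin q → ℝ} (hW : IsWeightSystem G H K L α β γ δ)
    (hδ : HasTraceWeights τ δ)
    (horth : ∀ x y, τ (fB x * fC y) =
      τ (fB (gB (condCoord τ (fB.comp gB) α (fB x))) * fC y)) :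
    ∃ S : CommutingSquare G H K L, S.HasWeights α β γ δ := by
  have hβ : HasTraceWeights (τ ∘ₗ fB.toAlgHom.toLinearMap) β := fun j e he => by
    rw [hW.β_eq]; exact hδ.comp hH hτ.tracial he
  have hγ : HasTraceWeights (τ ∘ₗ fC.toAlgHom.toLinearMap) γ := fun l e he => by
    rw [hW.γ_eq]; exact hδ.comp hL hτ.tracial he
  let fA : MultiMat a →⋆ₐ[ℂ] MultiMat d := fB.comp gB
  have hα : HasTraceWeights (τ ∘ₗ fA.toAlgHom.toLinearMap) α := fun i e he => by
    rw [hW.α_eq_G]; exact hβ.comp hG (tracial_comp hτ.tracial fB) he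
  have hA : ∀ x, τ (fA x) = ∑ i, (α i : ℂ) * (x i).trace :=
    hα.apply_eq (tracial_comp hτ.tracial fA)
  have hB : ∀ x, τ (fB x) = ∑ j, (β j : ℂ) * (x j).trace :=
    hβ.apply_eq (tracial_comp hτ.tracial fB)
  have hC : ∀ x, τ (fC x) = ∑ l, (γ l : ℂ) * (x l).trace :=
    hγ.apply_eq (tracial_comp hτ.tracial fC)
  have hδ0 : ∀ k, 0 ≤ δ k := fun k => (hW.δ_pos k).le
  have EA := isTraceCondExp_condCoord hτ hδ hδ0 hW.α_pos hA
  have EB := isTraceCondExp_condCoord hτ hδ hδ0 hW.β_pos hB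
  have EC := isTraceCondExp_condCoord hτ hδ hδ0 hW.γ_pos hC
  set eA := fA.toAlgHom.toLinearMap ∘ₗ condCoord τ fA α
  set eB := fB.toAlgHom.toLinearMap ∘ₗ condCoord τ fB β
  set eC := fC.toAlgHom.toLinearMap ∘ₗ condCoord τ fC γ
  have hAB : fA.range ≤ fB.range := by
    rintro _ ⟨x, rfl⟩
    exact ⟨gB x, rfl⟩
  have hAC : fA.range ≤ fC.range := by
    rintro _ ⟨x, rfl⟩
    exact ⟨gC x, (hcomm x).symm⟩
  have tA : ∀ z, ∀ y ∈ fA.range, τ (eA z * y) = τ (z * y) := by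
    rintro z _ ⟨y, rfl⟩
    exact tr_condCoord_mul (fun i => (hW.α_pos i).ne') hA z y
  have tB : ∀ z, ∀ y ∈ fB.range, τ (eB z * y) = τ (z * y) := by
    rintro z _ ⟨y, rfl⟩
    exact tr_condCoord_mul (fun i => (hW.β_pos i).ne') hB z y
  have tC : ∀ z, ∀ y ∈ fC.range, τ (eC z * y) = τ (z * y) := by
    rintro z _ ⟨y, rfl⟩
    exact tr_condCoord_mul (fun i => (hW.γ_pos i).ne') hC z y
  have horth' : ∀ x ∈ fB.range, ∀ y ∈ fC.range, τ (x * y) = τ (eA x * y) := by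
    rintro _ ⟨x, rfl⟩ _ ⟨y, rfl⟩
    exact horth x y
  have hCB : eC ∘ₗ eB = eA := by
    refine LinearMap.ext fun z => hτ.eq_of_forall_tr_mul (EC.mem _) (hAC (EA.mem z)) fun y hy => ?_
    have hAA : eA (eB z) = eA z := by
      refine hτ.eq_of_forall_tr_mul (EA.mem _) (EA.mem z) fun t ht => ?_
      rw [tA _ _ ht, tB _ _ (hAB ht), tA _ _ ht]
    rw [LinearMap.comp_apply, tC _ _ hy, horth' _ (EB.mem z) _ hy, hAA]
  -- The adjoint of `hCB` with respect to the trace form.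
  have hBC : eB ∘ₗ eC = eA := by
    refine LinearMap.ext fun z => hτ.eq_of_forall_tr_mul (EB.mem _) (hAB (EA.mem z)) fun y hy => ?_
    have h1 : eC y = eA y :=
      (congrArg eC (EB.apply_of_mem y hy)).symm.trans (LinearMap.congr_fun hCB y)
    rw [LinearMap.comp_apply, tB _ _ hy, hτ.tracial, ← tC y _ (EC.mem z), h1,
      hτ.tracial, tC _ _ (hAC (EA.mem y)), hτ.tracial (eA z), ← tA y _ (EA.mem z),
      hτ.tracial (eA y), tA _ _ (EA.mem y)]
  let SA := MultiMatSubalgebra.ofInjective ha fA (injective_of_trace_weights hW.α_pos hA)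
  let SB := MultiMatSubalgebra.ofInjective hb fB (injective_of_trace_weights hW.β_pos hB)
  let SC := MultiMatSubalgebra.ofInjective hc fC (injective_of_trace_weights hW.γ_pos hC)
  have iAB : SA.incl SB hAB = gB := by
    refine StarAlgHom.ext fun x => injective_of_trace_weights hW.β_pos hB ?_
    exact SA.toAmbient_incl SB hAB x
  have iAC : SA.incl SC hAC = gC := by
    refine StarAlgHom.ext fun x => injective_of_trace_weights hW.γ_pos hC ?_
    exact (SA.toAmbient_incl SC hAC x).trans (hcomm x)
  exact ⟨{ d := d, d_pos := hd, A := SA, B := SB, C := SC, hAB := hAB, hAC := hAC,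
           inclAB := by rw [iAB]; exact hG, inclBD := hH,
           inclAC := by rw [iAC]; exact hK, inclCD := hL, tr := τ, tr_state := hτ,
           EA := eA, EB := eB, EC := eC, condExpA := EA, condExpB := EB, condExpC := EC,
           comm_left := hBC, comm_right := hCB }, ⟨hα, hβ, hγ, hδ⟩⟩

/-! ### Inclusions given by a family of unitaries -/

/-- The amplification `⨁ i, x i ⊗ 1` of an element of a multi-matrix algebra, with `N i` copies of
the `i`-th summand. -/
def amplify {n : ℕ} {a : Fin n → ℕ} (N : Fin n → ℕ) (x : MultiMat a) :
    Matrix (EdgePairs a N) (EdgePairs a N) ℂ :=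
  Matrix.blockDiagonal' fun i => Matrix.kroneckerMap (· * ·) (x i)
    (1 : Matrix (Fin (N i)) (Fin (N i)) ℂ)

section amplify

variable {n : ℕ} {a : Fin n → ℕ} (N : Fin n → ℕ)

lemma amplify_one : amplify N (1 : MultiMat a) = 1 := by
  rw [amplify, ← Matrix.blockDiagonal'_one]
  congr 1
  funext i
  exact Matrix.one_kronecker_one

lemma amplify_mul (x y : MultiMat a) : amplify N (x * y) = amplify N x * amplify N y := by
  rw [amplify, amplify, amplify, ← Matrix.blockDiagonal'_mul]
  congr 1
  funext i
  rw [← Matrix.mul_kronecker_mul, Matrix.one_mul]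
  rfl

lemma amplify_star (x : MultiMat a) : amplify N (star x) = (amplify N x)ᴴ := by
  rw [amplify, amplify, Matrix.blockDiagonal'_conjTranspose]
  congr 1
  funext i
  rw [Matrix.conjTranspose_kronecker, Matrix.conjTranspose_one]
  rfl

lemma amplify_add (x y : MultiMat a) : amplify N (x + y) = amplify N x + amplify N y := by
  rw [amplify, amplify, amplify, ← Matrix.blockDiagonal'_add]
  congr 1
  funext i
  exact Matrix.add_kronecker (x i) (y i) 1

lemma amplify_smul (c : ℂ) (x : MultiMat a) : amplify N (c • x) = c • amplify N x := by
  rw [amplify, amplify, ← Matrix.blockDiagonal'_smul]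
  congr 1
  funext i
  exact Matrix.smul_kronecker c (x i) 1

lemma trace_amplify (x : MultiMat a) : (amplify N x).trace = ∑ i, (N i : ℂ) * (x i).trace := by
  rw [amplify, Matrix.trace_blockDiagonal']
  refine Finset.sum_congr rfl fun i _ => ?_
  rw [Matrix.trace_kronecker, Matrix.trace_one, Fintype.card_fin, mul_comm]

lemma amplify_diagonal (D : (i : Fin n) → Fin (a i) → ℂ) :
    amplify N (fun i => Matrix.diagonal (D i)) = Matrix.diagonal fun y => D y.1 y.2.1 := by
  rw [amplify, ← Matrix.blockDiagonal'_diagonal fun i (y : Fin (a i) × Fin (N i)) => D i y.1]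
  congr 1
  funext i
  rw [← Matrix.diagonal_one, Matrix.diagonal_kronecker_diagonal]
  simp

lemma amplify_matUnit (i : Fin n) (r s : Fin (a i)) :
    amplify N (matUnit i r s) = ∑ ν, Matrix.single ⟨i, r, ν⟩ ⟨i, s, ν⟩ (1 : ℂ) := by
  ext ⟨j, t, ν⟩ ⟨j', t', ν'⟩
  rw [Matrix.sum_apply]
  obtain rfl | hj := eq_or_ne j i
  · obtain rfl | hj' := eq_or_ne j' j
    · rw [amplify, Matrix.blockDiagonal'_apply_eq, Matrix.kroneckerMap_apply]
      simp only [matUnit, Pi.single_eq_same, Matrix.single_apply, Matrix.one_apply]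
      by_cases h : r = t ∧ s = t'
      · obtain ⟨rfl, rfl⟩ := h
        simp only [Sigma.mk.injEq, heq_eq_eq, Prod.mk.injEq, true_and, and_self, if_true, one_mul]
        by_cases hν : ν = ν'
        · subst hν
          simp
        · rw [if_neg hν, Finset.sum_eq_zero]
          rintro x -
          exact if_neg fun h => hν (h.1.symm.trans h.2)
      · rw [if_neg h, zero_mul, Finset.sum_eq_zero]
        intro x _
        rw [if_neg]
        rintro ⟨h1, h2⟩
        simp at h1 h2
        exact h ⟨h1.1, h2.1⟩
    · rw [amplify, Matrix.blockDiagonal'_apply_ne _ _ _ hj'.symm, Finset.sum_eq_zero]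
      intro x _
      simp [hj'.symm]
  · have h0 : amplify N (matUnit i r s) ⟨j, t, ν⟩ ⟨j', t', ν'⟩ = 0 := by
      obtain rfl | hj' := eq_or_ne j' j
      · rw [amplify, Matrix.blockDiagonal'_apply_eq, Matrix.kroneckerMap_apply]
        simp [matUnit, hj]
      · rw [amplify, Matrix.blockDiagonal'_apply_ne _ _ _ hj'.symm]
    rw [h0, Finset.sum_eq_zero]
    intro x _
    simp [hj.symm]

end amplify

/-- The unital `*`-homomorphism `x ↦ V_j (⨁ i, x i ⊗ 1) V_j⋆` with inclusion matrix `G`. -/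
def unitaryIncl {n m : ℕ} {a : Fin n → ℕ} {b : Fin m → ℕ} {G : Matrix (Fin n) (Fin m) ℕ}
    (V : ∀ j, Matrix (Fin (b j)) (EdgePairs a (fun i => G i j)) ℂ) (hV : ∀ j, IsUnitaryMat (V j)) :
    MultiMat a →⋆ₐ[ℂ] MultiMat b where
  toFun x j := V j * amplify (fun i => G i j) x * (V j)ᴴ
  map_one' := by
    funext j
    rw [amplify_one, Matrix.mul_one, (hV j).1]
    rfl
  map_mul' x y := by
    funext j
    simp only [Pi.mul_apply, amplify_mul]
    rw [Matrix.mul_assoc _ (V j)ᴴ, ← Matrix.mul_assoc (V j)ᴴ, ← Matrix.mul_assoc (V j)ᴴ,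
      (hV j).2, Matrix.one_mul]
    simp only [Matrix.mul_assoc]
  map_zero' := by
    funext j
    have := amplify_smul (fun i => G i j) 0 (0 : MultiMat a)
    rw [zero_smul, zero_smul] at this
    rw [this]
    simp
  map_add' x y := by
    funext j
    rw [amplify_add, Matrix.mul_add, Matrix.add_mul]
    rfl
  commutes' c := by
    funext j
    rw [Algebra.algebraMap_eq_smul_one, amplify_smul, amplify_one, Matrix.mul_smul, Matrix.mul_one,
      Matrix.smul_mul, (hV j).1, Algebra.algebraMap_eq_smul_one]
    rfl
  map_star' x := by
    funext j
    rw [amplify_star, Pi.star_apply, Matrix.star_eq_conjTranspose]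
    simp [Matrix.mul_assoc]

lemma unitaryIncl_apply {n m : ℕ} {a : Fin n → ℕ} {b : Fin m → ℕ} {G : Matrix (Fin n) (Fin m) ℕ}
    (V : ∀ j, Matrix (Fin (b j)) (EdgePairs a (fun i => G i j)) ℂ) (hV : ∀ j, IsUnitaryMat (V j))
    (x : MultiMat a) (j : Fin m) :
    unitaryIncl V hV x j = V j * amplify (fun i => G i j) x * (V j)ᴴ := rfl

lemma hasInclusionMatrix_unitaryIncl {n m : ℕ} {a : Fin n → ℕ} {b : Fin m → ℕ}
    {G : Matrix (Fin n) (Fin m) ℕ}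
    (V : ∀ j, Matrix (Fin (b j)) (EdgePairs a (fun i => G i j)) ℂ) (hV : ∀ j, IsUnitaryMat (V j)) :
    HasInclusionMatrix (unitaryIncl V hV) G := by
  intro i e he j
  have h := (isStarProjection_map_single (unitaryIncl V hV) he.1 j).trace_eq_rank
  rw [unitaryIncl_apply, Matrix.trace_mul_comm, ← Matrix.mul_assoc, (hV j).2, Matrix.one_mul,
    trace_amplify, Finset.sum_eq_single i] at h
  · rw [Pi.single_eq_same, he.1.trace_eq_rank, he.2, Nat.cast_one, mul_one] at h
    rw [unitaryIncl_apply]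
    exact_mod_cast h.symm
  · intro i' _ hi
    rw [Pi.single_eq_of_ne hi, Matrix.trace_zero, mul_zero]
  · simp

/-- If the unitaries only connect indices with the same label in `ι`, the inclusion maps elements
that are diagonal, with entries depending only on the label, to elements of the same kind. -/
lemma unitaryIncl_diagonal {ι : Type} {n m : ℕ} {a : Fin n → ℕ} {b : Fin m → ℕ}
    {G : Matrix (Fin n) (Fin m) ℕ}
    {V : ∀ j, Matrix (Fin (b j)) (EdgePairs a (fun i => G i j)) ℂ} (hV : ∀ j, IsUnitaryMat (V j))
    (χ : (i : Fin n) → Fin (a i) → ι) (χ' : (j : Fin m) → Fin (b j) → ι)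
    (h : ∀ j r y, χ' j r ≠ χ y.1 y.2.1 → V j r y = 0) (t : ι → ℂ) :
    unitaryIncl V hV (fun i => Matrix.diagonal fun s => t (χ i s)) =
      fun j => Matrix.diagonal fun r => t (χ' j r) := by
  funext j
  rw [unitaryIncl_apply, amplify_diagonal]
  have : V j * Matrix.diagonal (fun y : EdgePairs a (fun i => G i j) => t (χ y.1 y.2.1)) =
      Matrix.diagonal (fun r => t (χ' j r)) * V j := by
    ext r y
    rw [Matrix.mul_diagonal, Matrix.diagonal_mul]
    by_cases hr : χ' j r = χ y.1 y.2.1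
    · rw [hr, mul_comm]
    · rw [h j r y hr, zero_mul, mul_zero]
  rw [this, Matrix.mul_assoc, (hV j).1, Matrix.mul_one]

/-- The trace of a product of matrix units of two algebras amplified on the two sides of `W`, in
terms of the entries of `W`: multiplicities on both sides are summed out. -/
lemma trace_amplify_mul_matUnit {n p : ℕ} {b : Fin n → ℕ} {c : Fin p → ℕ} {N : Fin n → ℕ}
    {M : Fin p → ℕ} (W : Matrix (EdgePairs b N) (EdgePairs c M) ℂ) (j : Fin n) (l : Fin p)
    (s t : Fin (b j)) (s' t' : Fin (c l)) :
    (amplify N (matUnit j s t) * W * amplify M (matUnit l s' t') * Wᴴ).trace =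
      ∑ σ, ∑ ψ, W ⟨j, t, σ⟩ ⟨l, s', ψ⟩ * star (W ⟨j, s, σ⟩ ⟨l, t', ψ⟩) := by
  rw [amplify_matUnit, amplify_matUnit]
  rw [Matrix.sum_mul, Matrix.sum_mul, Matrix.sum_mul, Matrix.trace_sum]
  refine Finset.sum_congr rfl fun σ _ => ?_
  rw [Matrix.mul_sum, Matrix.sum_mul, Matrix.trace_sum]
  refine Finset.sum_congr rfl fun ψ _ => ?_
  rw [Matrix.single_mul_mul_single, Matrix.trace_single_mul, one_mul, mul_one]
  rfl

lemma trace_conj_mul_conj {X Y Z : Type} [Fintype X] [Fintype Y] [Fintype Z] [DecidableEq Y]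
    {P : Matrix X Y ℂ} (hP : Pᴴ * P = 1) (M : Matrix Y Y ℂ) (W : Matrix Y Z ℂ)
    (N : Matrix Z Z ℂ) :
    (P * M * Pᴴ * (P * W * N * (P * W)ᴴ)).trace = (M * W * N * Wᴴ).trace := by
  calc (P * M * Pᴴ * (P * W * N * (P * W)ᴴ)).trace
      = (P * (M * (Pᴴ * P) * W * N * Wᴴ) * Pᴴ).trace := by
        rw [Matrix.conjTranspose_mul]
        simp only [Matrix.mul_assoc]
    _ = _ := by rw [Matrix.trace_mul_comm, ← Matrix.mul_assoc, hP, Matrix.one_mul, Matrix.mul_one]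

lemma sum_trace_matUnit_mul {m : ℕ} {b : Fin m → ℕ} (w : Fin m → ℂ) (j : Fin m) (s t : Fin (b j))
    (x : MultiMat b) : ∑ j', w j' * ((matUnit j s t * x) j').trace = w j * x j t s := by
  rw [Finset.sum_eq_single j]
  · rw [Pi.mul_apply, matUnit, Pi.single_eq_same, Matrix.trace_single_mul, one_smul]
  · intro j' _ hj
    rw [Pi.mul_apply, matUnit, Pi.single_eq_of_ne hj, Matrix.zero_mul, Matrix.trace_zero, mul_zero]
  · simp

/-! ### From a bi-unitary pair to a commuting square -/

lemma IsUnitaryMat.submatrix_equiv {X Y X' Y' : Type} [Fintype X] [Fintype Y] [DecidableEq X]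
    [DecidableEq Y] [Fintype X'] [Fintype Y'] [DecidableEq X'] [DecidableEq Y']
    {w : Matrix X Y ℂ} (hw : IsUnitaryMat w) (e : X' ≃ X) (e' : Y' ≃ Y) :
    IsUnitaryMat (w.submatrix e e') := by
  constructor
  · rw [Matrix.conjTranspose_submatrix, Matrix.submatrix_mul_equiv, hw.1,
      Matrix.submatrix_one_equiv]
  · rw [Matrix.conjTranspose_submatrix, Matrix.submatrix_mul_equiv, hw.2,
      Matrix.submatrix_one_equiv]

lemma isUnitaryMat_one {X : Type} [Fintype X] [DecidableEq X] :
    IsUnitaryMat (1 : Matrix X X ℂ) := by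
  constructor <;> simp

lemma IsUnitaryMat.blockDiagonal' {n : ℕ} {X Y : Fin n → Type} [∀ i, Fintype (X i)]
    [∀ i, Fintype (Y i)] [∀ i, DecidableEq (X i)] [∀ i, DecidableEq (Y i)]
    {w : (i : Fin n) → Matrix (X i) (Y i) ℂ} (hw : ∀ i, IsUnitaryMat (w i)) :
    IsUnitaryMat (Matrix.blockDiagonal' w) := by
  constructor
  · rw [Matrix.blockDiagonal'_conjTranspose, ← Matrix.blockDiagonal'_mul,
      ← Matrix.blockDiagonal'_one]
    exact congrArg _ (funext fun i => (hw i).1)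
  · rw [Matrix.blockDiagonal'_conjTranspose, ← Matrix.blockDiagonal'_mul,
      ← Matrix.blockDiagonal'_one]
    exact congrArg _ (funext fun i => (hw i).2)

/-- The dimensions of a multi-matrix algebra containing `MultiMat a` with inclusion matrix `G`. -/
def pathDim {n m : ℕ} (a : Fin n → ℕ) (G : Matrix (Fin n) (Fin m) ℕ) (j : Fin m) : ℕ :=
  Fintype.card (EdgePairs a (fun i => G i j))

/-- An enumeration of the pairs of a basis index of the `i`-th summand and an edge `i → j`. -/
noncomputable def pathIndex {n m : ℕ} (a : Fin n → ℕ) (G : Matrix (Fin n) (Fin m) ℕ) (j : Fin m) :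
    Fin (pathDim a G j) ≃ EdgePairs a (fun i => G i j) :=
  (Fintype.equivFin _).symm

lemma pathDim_pos {n m : ℕ} {a : Fin n → ℕ} (ha : ∀ i, 0 < a i) {G : Matrix (Fin n) (Fin m) ℕ}
    (hG : ∀ j, ∃ i, G i j ≠ 0) (j : Fin m) : 0 < pathDim a G j := by
  obtain ⟨i, hi⟩ := hG j
  exact Fintype.card_pos_iff.2 ⟨⟨i, ⟨0, ha i⟩, ⟨0, Nat.pos_of_ne_zero hi⟩⟩⟩

/-- Reassociation of a two-step path `i → j → k`, grouping the paths by their starting point. -/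
noncomputable def pathEquiv {n m q : ℕ} (G : Matrix (Fin n) (Fin m) ℕ)
    (H : Matrix (Fin m) (Fin q) ℕ) (k : Fin q) :
    EdgePairs (pathDim (fun _ => 1) G) (fun j => H j k) ≃
      (i : Fin n) × EdgePairs (fun j => G i j) (fun j => H j k) where
  toFun y := ⟨(pathIndex _ G y.1 y.2.1).1, ⟨y.1, (pathIndex _ G y.1 y.2.1).2.2, y.2.2⟩⟩
  invFun x := ⟨x.2.1, (pathIndex _ G x.2.1).symm ⟨x.1, 0, x.2.2.1⟩, x.2.2.2⟩
  left_inv y := by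
    obtain ⟨j, s, σ⟩ := y
    simp only
    congr 2
    rw [Equiv.symm_apply_eq]
    refine Sigma.ext rfl (heq_of_eq (Prod.ext (Subsingleton.elim _ _) rfl))
  right_inv x := by
    obtain ⟨i, j, ρ, σ⟩ := x
    have h := (pathIndex (fun _ => 1) G j).apply_symm_apply ⟨i, 0, ρ⟩
    dsimp only
    generalize pathIndex (fun _ => 1) G j ((pathIndex (fun _ => 1) G j).symm ⟨i, 0, ρ⟩) = z at h ⊢
    subst h
    rfl

/-- The functional `∑ k, δ k Tr` on a multi-matrix algebra. -/
noncomputable def weightedTrace {q : ℕ} (d : Fin q → ℕ) (δ : Fin q → ℝ) : MultiMat d →ₗ[ℂ] ℂ where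
  toFun z := ∑ k, (δ k : ℂ) * (z k).trace
  map_add' x y := by simp [mul_add, Finset.sum_add_distrib]
  map_smul' c x := by simp [Finset.mul_sum, mul_left_comm]

lemma weightedTrace_apply {q : ℕ} (d : Fin q → ℕ) (δ : Fin q → ℝ) (z : MultiMat d) :
    weightedTrace d δ z = ∑ k, (δ k : ℂ) * (z k).trace := rfl

lemma isFaithfulTracialState_weightedTrace {q : ℕ} {d : Fin q → ℕ} {δ : Fin q → ℝ}
    (hδ : ∀ k, 0 < δ k) (h1 : ∑ k, δ k * d k = 1) :
    IsFaithfulTracialState (weightedTrace d δ) := by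
  have hδ' : ∀ k, 0 < (δ k : ℂ) := fun k => by exact_mod_cast hδ k
  have hnn : ∀ (x : MultiMat d) k, 0 ≤ (δ k : ℂ) * ((star x * x) k).trace := fun x k =>
    mul_nonneg (hδ' k).le (Matrix.posSemidef_conjTranspose_mul_self (x k)).trace_nonneg
  refine ⟨?_, fun x => Finset.sum_nonneg fun k _ => hnn x k, fun x hx => ?_, fun x y => ?_⟩
  · simp only [weightedTrace_apply, Pi.one_apply, Matrix.trace_one, Fintype.card_fin]
    exact_mod_cast h1
  · rw [weightedTrace_apply] at hx
    funext k
    have := (Finset.sum_eq_zero_iff_of_nonneg (fun k _ => hnn x k)).1 hx k (Finset.mem_univ k)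
    exact Matrix.trace_conjTranspose_mul_self_eq_zero_iff.1
      ((mul_eq_zero.1 this).resolve_left (hδ' k).ne')
  · rw [weightedTrace_apply, weightedTrace_apply]
    refine Finset.sum_congr rfl fun k _ => ?_
    rw [Pi.mul_apply, Matrix.trace_mul_comm]
    rfl

section

variable {n m p q : ℕ} {G : Matrix (Fin n) (Fin m) ℕ} {H : Matrix (Fin m) (Fin q) ℕ}
  {K : Matrix (Fin n) (Fin p) ℕ} {L : Matrix (Fin p) (Fin q) ℕ} {α : Fin n → ℝ} {β : Fin m → ℝ}
  {γ : Fin p → ℝ} {δ : Fin q → ℝ}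
  {u : (i : Fin n) → (k : Fin q) →
      Matrix (EdgePairs (fun j => G i j) (fun j => H j k))
        (EdgePairs (fun l => K i l) (fun l => L l k)) ℂ}
  {v : (j : Fin m) → (l : Fin p) →
      Matrix (EdgePairs (fun i => G i j) (fun i => K i l))
        (EdgePairs (fun k => H j k) (fun k => L l k)) ℂ}

/-- The block-diagonal matrix with blocks `u i k`, with indices regrouped by the middle vertex. -/
noncomputable def pathUnitary (u : (i : Fin n) → (k : Fin q) →
      Matrix (EdgePairs (fun j => G i j) (fun j => H j k))
        (EdgePairs (fun l => K i l) (fun l => L l k)) ℂ) (k : Fin q) :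
    Matrix (EdgePairs (pathDim (fun _ => 1) G) (fun j => H j k))
      (EdgePairs (pathDim (fun _ => 1) K) (fun l => L l k)) ℂ :=
  (Matrix.blockDiagonal' fun i => u i k).submatrix (pathEquiv G H k) (pathEquiv K L k)

lemma pathUnitary_apply (k : Fin q) (j : Fin m) (l : Fin p) (i i' : Fin n) (ρ : Fin (G i j))
    (φ : Fin (K i' l)) (σ : Fin (H j k)) (ψ : Fin (L l k)) :
    pathUnitary u k ⟨j, (pathIndex _ G j).symm ⟨i, 0, ρ⟩, σ⟩
      ⟨l, (pathIndex _ K l).symm ⟨i', 0, φ⟩, ψ⟩ =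
      Matrix.blockDiagonal' (fun i => u i k) ⟨i, j, ρ, σ⟩ ⟨i', l, φ, ψ⟩ := by
  rw [pathUnitary, Matrix.submatrix_apply]
  exact congrArg₂ _ ((pathEquiv G H k).apply_symm_apply ⟨i, j, ρ, σ⟩)
    ((pathEquiv K L k).apply_symm_apply ⟨i', l, φ, ψ⟩)

/-- Paths with different starting points are orthogonal under `pathUnitary`. -/
lemma pathUnitary_apply_eq_zero (k : Fin q)
    (x : EdgePairs (pathDim (fun _ => 1) G) (fun j => H j k))
    (y : EdgePairs (pathDim (fun _ => 1) K) (fun l => L l k))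
    (h : (pathIndex _ G x.1 x.2.1).1 ≠ (pathIndex _ K y.1 y.2.1).1) : pathUnitary u k x y = 0 := by
  rw [pathUnitary, Matrix.submatrix_apply]
  exact Matrix.blockDiagonal'_apply_ne _ _ _ h

lemma BiUnitary.smul (h : BiUnitary G H K L α β γ δ u v) {c : ℝ} (hc : 0 < c) :
    BiUnitary G H K L (fun i => c * α i) (fun j => c * β j) (fun l => c * γ l)
      (fun k => c * δ k) u v := by
  refine ⟨h.unitary_u, h.unitary_v, fun i j k l ρ σ φ ψ => ?_⟩
  have h1 : c * α i * (c * δ k) / (c * β j * (c * γ l)) = α i * δ k / (β j * γ l) := by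
    rw [mul_mul_mul_comm, mul_mul_mul_comm c (β j), mul_div_mul_left _ _ (mul_pos hc hc).ne']
  rw [h.relation, h1]

lemma IsWeightSystem.smul (h : IsWeightSystem G H K L α β γ δ) {c : ℝ} (hc : 0 < c) :
    IsWeightSystem G H K L (fun i => c * α i) (fun j => c * β j) (fun l => c * γ l)
      (fun k => c * δ k) := by
  refine ⟨fun i => mul_pos hc (h.α_pos i), fun i => mul_pos hc (h.β_pos i),
    fun i => mul_pos hc (h.γ_pos i), fun i => mul_pos hc (h.δ_pos i), fun j => ?_, fun l => ?_,
    fun i => ?_, fun i => ?_⟩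
  · simp only [h.β_eq, Finset.mul_sum, mul_left_comm]
  · simp only [h.γ_eq, Finset.mul_sum, mul_left_comm]
  · simp only [h.α_eq_G, Finset.mul_sum, mul_left_comm]
  · simp only [h.α_eq_K, Finset.mul_sum, mul_left_comm]

/-- The orthonormality of the rows of `v`, in terms of `u`. -/
lemma BiUnitary.sum_mul_star (h : BiUnitary G H K L α β γ δ u v)
    (hW : IsWeightSystem G H K L α β γ δ) (j : Fin m) (l : Fin p) (i i' : Fin n) (ρ : Fin (G i j))
    (ρ' : Fin (G i' j)) (φ : Fin (K i l)) (φ' : Fin (K i' l)) :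
    ∑ k, (δ k : ℂ) *
        ∑ σ, ∑ ψ, u i k ⟨j, ρ, σ⟩ ⟨l, φ, ψ⟩ * star (u i' k ⟨j, ρ', σ⟩ ⟨l, φ', ψ⟩) =
      if (⟨i, ρ, φ⟩ : EdgePairs (fun i => G i j) (fun i => K i l)) = ⟨i', ρ', φ'⟩
        then (β j * γ l / α i : ℂ) else 0 := by
  have h1 := mul_conjTranspose_apply_of_relation (fun i => (hW.α_pos i).le)
    (fun i => (hW.β_pos i).le) (fun i => (hW.γ_pos i).le) (fun i => (hW.δ_pos i).le)
    h.relation j l i i' ρ ρ' φ φ'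
  rw [(h.unitary_v j l).1, Matrix.one_apply] at h1
  have hα := hW.α_pos i
  have hα' := hW.α_pos i'
  have hβ := hW.β_pos j
  have hγ := hW.γ_pos l
  have h2 : ((Real.sqrt (α i * α i') / (β j * γ l) : ℝ) : ℂ) ≠ 0 := by
    exact_mod_cast (by positivity : Real.sqrt (α i * α i') / (β j * γ l) ≠ 0)
  split_ifs at h1 ⊢ with hx
  · obtain ⟨rfl, -⟩ := Sigma.mk.inj_iff.1 hx
    rw [Real.sqrt_mul_self hα.le] at h1 h2
    rw [← mul_right_inj' h2, ← h1]
    push_cast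
    have hα₁ : (α i : ℂ) ≠ 0 := by exact_mod_cast hα.ne'
    have hβ₁ : (β j : ℂ) ≠ 0 := by exact_mod_cast hβ.ne'
    have hγ₁ : (γ l : ℂ) ≠ 0 := by exact_mod_cast hγ.ne'
    field_simp
  · exact (mul_eq_zero.1 h1.symm).resolve_left h2

/-- The commuting square of a bi-unitary pair: `A = ℂⁿ`, the summands of `B`, `C` and `D` act on
the spaces spanned by paths in the inclusion graphs, and the paths through `C` are identified with
the paths through `B` by means of `u`. -/
theorem BiUnitary.exists_commutingSquare_of_sum_eq_one (h : BiUnitary G H K L α β γ δ u v)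
    (hW : IsWeightSystem G H K L α β γ δ) (hGcol : ∀ j, ∃ i, G i j ≠ 0)
    (hHcol : ∀ k, ∃ j, H j k ≠ 0) (hKcol : ∀ l, ∃ i, K i l ≠ 0)
    (h1 : ∑ k, δ k * pathDim (pathDim (fun _ => 1) G) H k = 1) :
    ∃ S : CommutingSquare G H K L, S.HasWeights α β γ δ := by
  let eB := pathIndex (fun _ => 1) G
  let eC := pathIndex (fun _ => 1) K
  let eD := pathIndex (pathDim (fun _ => 1) G) H
  have ha : ∀ _ : Fin n, 0 < 1 := fun _ => one_pos
  have hb := pathDim_pos ha hGcol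
  have hc := pathDim_pos ha hKcol
  have hd := pathDim_pos hb hHcol
  have hW' : ∀ k, IsUnitaryMat (pathUnitary u k) := fun k =>
    (IsUnitaryMat.blockDiagonal' fun i => h.unitary_u i k).submatrix_equiv _ _
  have hgB : ∀ j, IsUnitaryMat ((1 : Matrix _ _ ℂ).submatrix (eB j) (Equiv.refl _)) :=
    fun j => isUnitaryMat_one.submatrix_equiv _ _
  have hgC : ∀ l, IsUnitaryMat ((1 : Matrix _ _ ℂ).submatrix (eC l) (Equiv.refl _)) :=
    fun l => isUnitaryMat_one.submatrix_equiv _ _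
  have hfB : ∀ k, IsUnitaryMat ((1 : Matrix _ _ ℂ).submatrix (eD k) (Equiv.refl _)) :=
    fun k => isUnitaryMat_one.submatrix_equiv _ _
  have hfC : ∀ k, IsUnitaryMat ((pathUnitary u k).submatrix (eD k) (Equiv.refl _)) :=
    fun k => (hW' k).submatrix_equiv _ _
  -- Only the embedding of `C` into `D` involves `u`.
  let gB := unitaryIncl (a := fun _ => 1) (G := G) _ hgB
  let gC := unitaryIncl (a := fun _ => 1) (G := K) _ hgC
  let fB := unitaryIncl (a := pathDim (fun _ => 1) G) (G := H) _ hfB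
  let fC := unitaryIncl (a := pathDim (fun _ => 1) K) (G := L) _ hfC
  have hG : HasInclusionMatrix gB G := hasInclusionMatrix_unitaryIncl _ _
  have hK : HasInclusionMatrix gC K := hasInclusionMatrix_unitaryIncl _ _
  have hH : HasInclusionMatrix fB H := hasInclusionMatrix_unitaryIncl _ _
  have hL : HasInclusionMatrix fC L := hasInclusionMatrix_unitaryIncl _ _
  -- Elements of `A = ℂⁿ` act by scalars on the paths with a given starting point.
  have hone : ∀ x : MultiMat (fun _ : Fin n => 1),
      x = fun i => Matrix.diagonal fun _ => x i 0 0 := by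
    intro x
    funext i
    ext r s
    rw [Subsingleton.elim r 0, Subsingleton.elim s 0, Matrix.diagonal_apply_eq]
  have hgBx : ∀ x : MultiMat (fun _ : Fin n => 1),
      gB x = fun j => Matrix.diagonal fun r => x (eB j r).1 0 0 := by
    intro x
    conv_lhs => rw [hone x]
    refine unitaryIncl_diagonal hgB (fun i _ => i) (fun j r => (eB j r).1) (fun j r y hy => ?_)
      (fun i => x i 0 0)
    exact Matrix.one_apply_ne fun h => hy (congrArg Sigma.fst h)
  have hgCx : ∀ x : MultiMat (fun _ : Fin n => 1),
      gC x = fun j => Matrix.diagonal fun r => x (eC j r).1 0 0 := by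
    intro x
    conv_lhs => rw [hone x]
    refine unitaryIncl_diagonal hgC (fun i _ => i) (fun j r => (eC j r).1) (fun j r y hy => ?_)
      (fun i => x i 0 0)
    exact Matrix.one_apply_ne fun h => hy (congrArg Sigma.fst h)
  have hcomm : ∀ x, fB (gB x) = fC (gC x) := by
    intro x
    rw [hgBx, hgCx]
    refine (unitaryIncl_diagonal hfB (fun j r => (eB j r).1)
      (fun k r => (eB (eD k r).1 (eD k r).2.1).1) (fun k r y hy => ?_)
      (fun i => x i 0 0)).trans (unitaryIncl_diagonal hfC (fun l r => (eC l r).1)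
      (fun k r => (eB (eD k r).1 (eD k r).2.1).1) (fun k r y hy => ?_) (fun i => x i 0 0)).symm
    · exact Matrix.one_apply_ne fun h => hy (by rw [h]; rfl)
    · exact pathUnitary_apply_eq_zero k _ _ hy
  let τ := weightedTrace (pathDim (pathDim (fun _ => 1) G) H) δ
  have hτ : IsFaithfulTracialState τ := isFaithfulTracialState_weightedTrace hW.δ_pos h1
  have hδ : HasTraceWeights τ δ := hasTraceWeights_of_apply_eq fun x => rfl
  have hB : ∀ x, τ (fB x) = ∑ j, (β j : ℂ) * (x j).trace := by
    refine HasTraceWeights.apply_eq (τ := τ ∘ₗ fB.toAlgHom.toLinearMap) (fun j e he => ?_)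
      (tracial_comp hτ.tracial fB)
    rw [hW.β_eq]
    exact hδ.comp hH hτ.tracial he
  have hC : ∀ x, τ (fC x) = ∑ l, (γ l : ℂ) * (x l).trace := by
    refine HasTraceWeights.apply_eq (τ := τ ∘ₗ fC.toAlgHom.toLinearMap) (fun j e he => ?_)
      (tracial_comp hτ.tracial fC)
    rw [hW.γ_eq]
    exact hδ.comp hL hτ.tracial he
  refine exists_commutingSquare ha hb hc hd hcomm hG hH hK hL hτ hW hδ fun x y => ?_
  -- By bilinearity it suffices to consider matrix units.
  suffices hu : ∀ j s t l s' t', τ (fB (matUnit j s t) * fC (matUnit l s' t')) =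
      τ (fB (gB (condCoord τ (fB.comp gB) α (fB (matUnit j s t)))) * fC (matUnit l s' t')) by
    rw [eq_sum_matUnit x, eq_sum_matUnit y]
    simp only [map_sum, map_smul, Finset.sum_mul, Finset.mul_sum, smul_mul_assoc, mul_smul_comm,
      hu]
  intro j s t l s' t'
  obtain ⟨⟨i, o, ρ⟩, rfl⟩ := (eB j).symm.surjective s
  obtain ⟨⟨i', o', ρ'⟩, rfl⟩ := (eB j).symm.surjective t
  obtain ⟨⟨i₁, o₁, φ⟩, rfl⟩ := (eC l).symm.surjective s'
  obtain ⟨⟨i₁', o₁', φ'⟩, rfl⟩ := (eC l).symm.surjective t'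
  obtain rfl := Subsingleton.elim o 0
  obtain rfl := Subsingleton.elim o' 0
  obtain rfl := Subsingleton.elim o₁ 0
  obtain rfl := Subsingleton.elim o₁' 0
  set s := (eB j).symm ⟨i, 0, ρ⟩ with hs
  set t := (eB j).symm ⟨i', 0, ρ'⟩ with ht
  set s' := (eC l).symm ⟨i₁, 0, φ⟩ with hs'
  set t' := (eC l).symm ⟨i₁', 0, φ'⟩ with ht'
  -- The trace of the product in terms of `u`.
  have hlhs : τ (fB (matUnit j s t) * fC (matUnit l s' t')) = ∑ k, (δ k : ℂ) *
      ∑ σ, ∑ ψ, Matrix.blockDiagonal' (fun i => u i k) ⟨i', j, ρ', σ⟩ ⟨i₁, l, φ, ψ⟩ *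
        star (Matrix.blockDiagonal' (fun i => u i k) ⟨i, j, ρ, σ⟩ ⟨i₁', l, φ', ψ⟩) := by
    rw [weightedTrace_apply]
    refine Finset.sum_congr rfl fun k _ => ?_
    have hP : (pathUnitary u k).submatrix (eD k) (Equiv.refl _) =
        (1 : Matrix _ _ ℂ).submatrix (eD k) (Equiv.refl _) * pathUnitary u k := by
      conv_lhs => rw [← Matrix.one_mul (pathUnitary u k)]
      exact (Matrix.submatrix_mul_equiv _ _ _ (Equiv.refl _) _).symm
    have hk : ((fB (matUnit j s t) * fC (matUnit l s' t')) k).trace =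
        ∑ σ, ∑ ψ, pathUnitary u k ⟨j, t, σ⟩ ⟨l, s', ψ⟩ *
          star (pathUnitary u k ⟨j, s, σ⟩ ⟨l, t', ψ⟩) := by
      refine Eq.trans ?_ ((trace_conj_mul_conj (hfB k).2 (amplify _ (matUnit j s t))
        (pathUnitary u k) (amplify _ (matUnit l s' t'))).trans (trace_amplify_mul_matUnit ..))
      exact congrArg
        (fun Z : Matrix (Fin _) (EdgePairs (pathDim (fun _ => 1) K) (fun l => L l k)) ℂ =>
          (fB (matUnit j s t) k *
            (Z * amplify (fun l => L l k) (matUnit l s' t') * Zᴴ)).trace) hP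
    rw [hk]
    congr 1
    refine Finset.sum_congr rfl fun σ _ => Finset.sum_congr rfl fun ψ _ => ?_
    exact congrArg₂ (fun x y => x * star y) (pathUnitary_apply ..) (pathUnitary_apply ..)
  -- The value required by the commuting square condition.
  have hrhs : τ (fB (gB (condCoord τ (fB.comp gB) α (fB (matUnit j s t)))) *
      fC (matUnit l s' t')) =
      if s' = t' ∧ s = t ∧ i = i₁ then (β j * γ l / α i₁ : ℂ) else 0 := by
    rw [hcomm, hτ.tracial, ← map_mul fC, hC, sum_trace_matUnit_mul (fun l => (γ l : ℂ)), hgCx]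
    dsimp only
    rw [Matrix.diagonal_apply]
    have hcoord : condCoord τ (fB.comp gB) α (fB (matUnit j s t)) i₁ 0 0 =
        if s = t ∧ i = i₁ then (β j / α i₁ : ℂ) else 0 := by
      rw [condCoord_apply, StarAlgHom.comp_apply, ← map_mul fB, hB,
        sum_trace_matUnit_mul (fun j => (β j : ℂ)), hgBx]
      dsimp only
      rw [Matrix.diagonal_apply]
      by_cases h : s = t
      · have ht₁ : (eB j t).1 = i := by rw [← h, hs, Equiv.apply_symm_apply]
        rw [if_pos h.symm, ht₁]
        by_cases hi : i = i₁
        · subst hi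
          rw [if_pos ⟨h, rfl⟩]
          simp [matUnit, div_eq_inv_mul]
        · rw [if_neg fun h => hi h.2]
          simp [matUnit, hi]
      · rw [if_neg (Ne.symm h), if_neg fun h' => h h'.1, mul_zero, mul_zero]
    by_cases h : s' = t'
    · have hs₁ : (eC l t').1 = i₁ := by rw [← h, hs', Equiv.apply_symm_apply]
      rw [if_pos h.symm, hs₁, hcoord]
      by_cases h' : s = t ∧ i = i₁
      · rw [if_pos h', if_pos ⟨h, h'⟩]
        ring
      · rw [if_neg h', if_neg fun h => h' h.2, mul_zero]
    · rw [if_neg (Ne.symm h), if_neg fun h' => h h'.1, mul_zero]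
  rw [hlhs, hrhs]
  by_cases hi : i' = i₁ ∧ i = i₁'
  · obtain ⟨rfl, rfl⟩ := hi
    simp only [Matrix.blockDiagonal'_apply_eq]
    rw [h.sum_mul_star hW]
    refine if_congr ?_ rfl rfl
    rw [hs, ht, hs', ht', Equiv.apply_eq_iff_eq, Equiv.apply_eq_iff_eq]
    constructor
    · intro h
      obtain ⟨rfl, h⟩ := Sigma.mk.inj_iff.1 h
      obtain ⟨rfl, rfl⟩ := Prod.mk_inj.1 (eq_of_heq h)
      exact ⟨rfl, rfl, rfl⟩
    · rintro ⟨h1, h2, rfl⟩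
      have h1' := (Prod.mk_inj.1 (eq_of_heq (Sigma.mk.inj_iff.1 h1).2)).2
      have h2' := (Prod.mk_inj.1 (eq_of_heq (Sigma.mk.inj_iff.1 h2).2)).2
      rw [h1', h2']
  · rw [if_neg]
    · refine Finset.sum_eq_zero fun k _ => ?_
      rw [Finset.sum_eq_zero, mul_zero]
      intro σ _
      refine Finset.sum_eq_zero fun ψ _ => ?_
      rw [not_and_or] at hi
      obtain hi | hi := hi
      · rw [Matrix.blockDiagonal'_apply_ne _ _ _ hi, zero_mul]
      · rw [Matrix.blockDiagonal'_apply_ne (fun i => u i k) (k := i) (k' := i₁') _ _ hi, star_zero,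
          mul_zero]
    · rintro ⟨h1, h2, rfl⟩
      exact hi ⟨(congrArg Sigma.fst ((eB j).symm.injective h2)).symm,
        congrArg Sigma.fst ((eC l).symm.injective h1)⟩

/-- The trace with weights `δ` is rescaled to a state. -/
theorem BiUnitary.exists_commutingSquare (hn : 0 < n) (h : BiUnitary G H K L α β γ δ u v)
    (hW : IsWeightSystem G H K L α β γ δ) (hGcol : ∀ j, ∃ i, G i j ≠ 0)
    (hHcol : ∀ k, ∃ j, H j k ≠ 0) (hKcol : ∀ l, ∃ i, K i l ≠ 0) :
    ∃ (S : CommutingSquare G H K L) (c : ℝ), 0 < c ∧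
      S.HasWeights (fun i => c * α i) (fun j => c * β j) (fun l => c * γ l)
        (fun k => c * δ k) := by
  have hd := pathDim_pos (pathDim_pos (fun _ : Fin n => one_pos) hGcol) hHcol
  have hterm : ∀ k, 0 < δ k * pathDim (pathDim (fun _ => 1) G) H k := fun k =>
    mul_pos (hW.δ_pos k) (by exact_mod_cast hd k)
  -- As `n > 0`, positivity of the weights forces `m > 0` and `q > 0`.
  obtain ⟨j⟩ : Nonempty (Fin m) := by
    by_contra hm
    rw [not_nonempty_iff] at hm
    have := hW.α_pos ⟨0, hn⟩
    rw [hW.α_eq_G, Finset.univ_eq_empty, Finset.sum_empty] at this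
    exact lt_irrefl _ this
  have hq : Nonempty (Fin q) := by
    by_contra hq
    rw [not_nonempty_iff] at hq
    have := hW.β_pos j
    rw [hW.β_eq, Finset.univ_eq_empty, Finset.sum_empty] at this
    exact lt_irrefl _ this
  have hsum : 0 < ∑ k, δ k * pathDim (pathDim (fun _ => 1) G) H k :=
    Finset.sum_pos (fun k _ => hterm k) Finset.univ_nonempty
  have hc := inv_pos.2 hsum
  obtain ⟨S, hS⟩ := (h.smul hc).exists_commutingSquare_of_sum_eq_one (hW.smul hc) hGcol hHcol hKcol
    (by simp only [mul_assoc, ← Finset.mul_sum]; exact inv_mul_cancel₀ hsum.ne')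
  exact ⟨S, _, hc, hS⟩

end

theorem mainTheorem1 {n m p q : ℕ} (hn : 0 < n)
    (G : Matrix (Fin n) (Fin m) ℕ) (H : Matrix (Fin m) (Fin q) ℕ)
    (K : Matrix (Fin n) (Fin p) ℕ) (L : Matrix (Fin p) (Fin q) ℕ)
    (hGcol : ∀ j, ∃ i, G i j ≠ 0) (hHcol : ∀ k, ∃ j, H j k ≠ 0)
    (hKcol : ∀ l, ∃ i, K i l ≠ 0) (hLcol : ∀ k, ∃ l, L l k ≠ 0)
    (hGH : G * H = K * L) (hGK : Gᵀ * K = H * Lᵀ) :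
    (Nonempty (CommutingSquare G H K L) ↔
      ∃ (α : Fin n → ℝ) (β : Fin m → ℝ) (γ : Fin p → ℝ) (δ : Fin q → ℝ),
        IsWeightSystem G H K L α β γ δ ∧ ∃ u v, BiUnitary G H K L α β γ δ u v) ∧
    (∀ (α : Fin n → ℝ) (β : Fin m → ℝ) (γ : Fin p → ℝ) (δ : Fin q → ℝ),
      IsWeightSystem G H K L α β γ δ →
        ((∃ (S : CommutingSquare G H K L) (c : ℝ), 0 < c ∧
            S.HasWeights (fun i => c * α i) (fun j => c * β j)
              (fun l => c * γ l) (fun k => c * δ k)) ↔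
          ∃ u v, BiUnitary G H K L α β γ δ u v)) := by
  refine ⟨⟨fun ⟨S⟩ => ?_, ?_⟩, fun α β γ δ hW => ⟨?_, ?_⟩⟩
  · obtain ⟨α, β, γ, δ, hW, hS⟩ := S.exists_hasWeights
    exact ⟨α, β, γ, δ, hW, S.exists_biUnitary hGK hS hW.α_pos hW.β_pos hW.γ_pos hW.δ_pos⟩
  · rintro ⟨α, β, γ, δ, hW, u, v, h⟩
    obtain ⟨S, -⟩ := h.exists_commutingSquare hn hW hGcol hHcol hKcol
    exact ⟨S⟩
  · rintro ⟨S, c, hc, hS⟩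
    have hcW := hW.smul hc
    obtain ⟨u, v, h⟩ := S.exists_biUnitary hGK hS hcW.α_pos hcW.β_pos hcW.γ_pos hcW.δ_pos
    refine ⟨u, v, ?_⟩
    simpa [inv_mul_cancel_left₀ hc.ne'] using h.smul (inv_pos.2 hc)
  · rintro ⟨u, v, h⟩
    exact h.exists_commutingSquare hn hW hGcol hHcol hKcol
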